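/- For a simplicial set $K$ and $m \ge 0$, let $B^m(K)$ be the space of bounded functions $c : K_m \to \mathbb{R}$ with the supremum norm, let $\partial^* : B^m(K) \to B^{m+1}(K)$, $\partial^* c(\sigma) = \sum_{i=0}^{m+1} (-1)^i c(\partial_i \sigma)$, and let the bounded cohomology $\widehat{H}^m(K)$ be the $m$-th cohomology of the complex $(B^*(K), \partial^*)$, equipped with the semi-norm that assigns to a class the infimum of the norms of the bounded cocycles representing it. For an abelian group $\pi$ and $n \ge 1$, let $K(\pi,n)$ be the Eilenberg–MacLane simplicial set: its $q$-simplices are the normalized $n$-cocycles (those vanishing on degenerate simplices) of the standard simplex $\Delta[q]$ with coefficients in $\pi$, and the structure map of a non-decreasing map $\theta : [r] \to [q]$ is the pull-back of cocycles by $\theta_* : \Delta[r] \to \Delta[q]$. A simplicial map $p : E \to B$ is a locally trivial bundle with fiber $F$ if, for every $q \ge 0$ and every $q$-simplex $\sigma$ of $B$ with corresponding map $i_\sigma : \Delta[q] \to B$, the pull-back $i_\sigma^* p : i_\sigma^* E \to \Delta[q]$ is isomorphic over $\Delta[q]$ to the projection $\Delta[q] \times F \to \Delta[q]$. **Theorem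 A.** Let $E, B$ be simplicial sets, let $\pi$ be an abelian group, let $n > 1$, and let $p : E \to B$ be a locally trivial bundle with fiber $K(\pi,n)$. Then for every $m \ge 0$ the induced map $p^* : \widehat{H}^m(B) \to \widehat{H}^m(E)$ is an isometric isomorphism, i.e. it is a linear bijection and $\|p^*(x)\| = \|x\|$ for all $x \in \widehat{H}^m(B)$. -/

import Mathlib

open CategoryTheory MonoidalCategory

universe u

section

open Simplicial

/-! ### Locally trivial bundles of simplicial sets -/

/-- The total space `i^* E` of the pull-back of `p : E ⟶ B` by `i : A ⟶ B`: its `q`-simplices are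
the pairs `(σ, τ)` of `q`-simplices of `E` and `A` such that `p σ = i τ`. -/
def pullbackTotal {E B A : SSet.{u}} (p : E ⟶ B) (i : A ⟶ B) : SSet.{u} where
  obj q := { x : E.obj q × A.obj q // p.app q x.1 = i.app q x.2 }
  map θ := TypeCat.ofHom fun x =>
    ⟨(E.map θ x.1.1, A.map θ x.1.2), by
      rw [NatTrans.naturality_apply, NatTrans.naturality_apply, x.2]⟩

/-- The pull-back `i^* p : i^* E ⟶ A` of `p : E ⟶ B` by `i : A ⟶ B`. -/
def pullbackProj {E B A : SSet.{u}} (p : E ⟶ B) (i : A ⟶ B) : pullbackTotal p i ⟶ A where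
  app _ := TypeCat.ofHom fun x => x.1.2

/-- `p : E ⟶ B` is a trivial bundle with fiber `F`: there is an isomorphism `t : B × F ≅ E` with
`p ∘ t` equal to the projection `B × F ⟶ B` (here `⊗` is the product of simplicial sets). -/
def IsTrivialBundle {E B : SSet.{u}} (p : E ⟶ B) (F : SSet.{u}) : Prop :=
  ∃ t : B ⊗ F ≅ E, t.hom ≫ p = SemiCartesianMonoidalCategory.fst B F

/-- `p : E ⟶ B` is a locally trivial bundle with fiber `F`: its pull-back by the map
`i_σ : Δ[q] ⟶ B` is a trivial bundle with fiber `F` for every simplex `σ` of `B`. -/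
def IsLocallyTrivialBundle {E B : SSet.{u}} (p : E ⟶ B) (F : SSet.{u}) : Prop :=
  ∀ (q : ℕ) (σ : B _⦋q⦌), IsTrivialBundle (pullbackProj p (SSet.yonedaEquiv.symm σ)) F

/-! ### Simplicial cochains -/

/-- The simplicial coboundary `∂^* c (σ) = ∑ i, (-1)^i c (∂_i σ)` of an `n`-cochain `c`. -/
def coboundary {A : Type*} [AddCommGroup A] (K : SSet.{u}) (n : ℕ) :
    (K _⦋n⦌ → A) →+ (K _⦋n + 1⦌ → A) where
  toFun c σ := ∑ i : Fin (n + 2), (-1 : ℤ) ^ (i : ℕ) • c (K.δ i σ)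
  map_zero' := by ext; simp
  map_add' c d := by ext; simp [Finset.sum_add_distrib]

theorem coboundary_comp {A : Type*} [AddCommGroup A] {K L : SSet.{u}} (f : K ⟶ L) (n : ℕ)
    (c : L _⦋n⦌ → A) :
    coboundary K n (fun σ => c (f.app _ σ)) = fun σ => coboundary L n c (f.app _ σ) := by
  ext σ
  simp [coboundary, SSet.δ_naturality_apply]

/-! ### Eilenberg–MacLane simplicial sets -/

/-- The group `Z^n(K, π)` of normalized `n`-cocycles of `K` with coefficients in `π`: cochains that
vanish on all degenerate simplices and have zero coboundary. -/
def normalizedCocycles (π : Type u) [AddCommGroup π] (n : ℕ) (K : SSet.{u}) :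
    AddSubgroup (K _⦋n⦌ → π) where
  carrier := { c | (∀ σ ∈ K.degenerate n, c σ = 0) ∧ coboundary K n c = 0 }
  zero_mem' := ⟨fun _ _ => rfl, map_zero _⟩
  add_mem' {a b} ha hb :=
    ⟨fun σ h => by simp [ha.1 σ h, hb.1 σ h], by rw [map_add, ha.2, hb.2, add_zero]⟩
  neg_mem' {a} ha := ⟨fun σ h => by simp [ha.1 σ h], by rw [map_neg, ha.2, neg_zero]⟩

/-- The pull-back of normalized cocycles by a simplicial map. -/
def normalizedCocyclesMap (π : Type u) [AddCommGroup π] (n : ℕ) {K L : SSet.{u}} (f : K ⟶ L)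
    (c : normalizedCocycles π n L) : normalizedCocycles π n K :=
  ⟨fun σ => c.1 (f.app _ σ),
    fun σ hσ => c.2.1 _ (SSet.degenerate_app_apply hσ f),
    by rw [coboundary_comp, c.2.2]; rfl⟩

/-- The contravariant functor `K ↦ Z^n(K, π)`. -/
def normalizedCocyclesFunctor (π : Type u) [AddCommGroup π] (n : ℕ) : SSet.{u}ᵒᵖ ⥤ Type u where
  obj K := normalizedCocycles π n K.unop
  map f := TypeCat.ofHom (normalizedCocyclesMap π n f.unop)

/-- The Eilenberg–MacLane simplicial set `K(π, n)`: its `q`-simplices are the normalized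
`n`-cocycles of `Δ[q]` with coefficients in `π`, and the structure map of `θ : [r] ⟶ [q]` is the
pull-back of cocycles by `θ_* : Δ[r] ⟶ Δ[q]`. -/
def eilenbergMacLane (π : Type u) [AddCommGroup π] (n : ℕ) : SSet.{u} :=
  Functor.op (C := SimplexCategory) SSet.stdSimplex.{u} ⋙ normalizedCocyclesFunctor π n

/-! ### Bounded cohomology -/

/-- The space `B^n(K)` of bounded real `n`-cochains of `K`, with the supremum norm. -/
abbrev BoundedCochain (K : SSet.{u}) (n : ℕ) : Type u :=
  lp (fun _ : K _⦋n⦌ => ℝ) ⊤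

theorem memℓp_coboundary {K : SSet.{u}} {n : ℕ} (c : BoundedCochain K n) :
    Memℓp (E := fun _ : K _⦋n + 1⦌ => ℝ) (coboundary K n (c : K _⦋n⦌ → ℝ)) ⊤ := by
  refine memℓp_infty ⟨∑ _i : Fin (n + 2), ‖c‖, ?_⟩
  rintro _ ⟨σ, rfl⟩
  change ‖∑ i : Fin (n + 2), (-1 : ℤ) ^ (i : ℕ) • (c : K _⦋n⦌ → ℝ) (K.δ i σ)‖ ≤ _
  refine (norm_sum_le (E := ℝ) _ _).trans (Finset.sum_le_sum fun i _ => ?_)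
  rw [norm_smul]
  simpa using lp.norm_apply_le_norm (E := fun _ : K _⦋n⦌ => ℝ) ENNReal.top_ne_zero c (K.δ i σ)

/-- The coboundary operator `∂^* : B^n(K) ⟶ B^{n+1}(K)`. -/
noncomputable def boundedCoboundary (K : SSet.{u}) (n : ℕ) :
    BoundedCochain K n →ₗ[ℝ] BoundedCochain K (n + 1) where
  toFun c := ⟨coboundary K n (c : K _⦋n⦌ → ℝ), memℓp_coboundary c⟩
  map_add' c d := Subtype.ext (map_add (coboundary K n) (c : K _⦋n⦌ → ℝ) d)
  map_smul' r c := by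
    ext σ
    simp [coboundary, Finset.mul_sum, mul_left_comm]

/-- The map `f^* : B^n(L) ⟶ B^n(K)` induced by a simplicial map `f : K ⟶ L`. -/
noncomputable def boundedCochainMap {K L : SSet.{u}} (f : K ⟶ L) (n : ℕ) :
    BoundedCochain L n →ₗ[ℝ] BoundedCochain K n where
  toFun c := ⟨fun σ => c (f.app _ σ), memℓp_infty ⟨‖c‖, by
    rintro _ ⟨σ, rfl⟩
    exact lp.norm_apply_le_norm (E := fun _ : L _⦋n⦌ => ℝ) ENNReal.top_ne_zero c _⟩⟩
  map_add' _ _ := rfl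
  map_smul' _ _ := rfl

theorem boundedCoboundary_map {K L : SSet.{u}} (f : K ⟶ L) (n : ℕ) (c : BoundedCochain L n) :
    boundedCoboundary K n (boundedCochainMap f n c) =
      boundedCochainMap f (n + 1) (boundedCoboundary L n c) :=
  Subtype.ext (coboundary_comp f n (c : L _⦋n⦌ → ℝ))

end

/-- The bounded `n`-cocycles of `K`. -/
noncomputable abbrev boundedCocycles (K : SSet.{u}) (n : ℕ) : Submodule ℝ (BoundedCochain K n) :=
  LinearMap.ker (boundedCoboundary K n)

/-- The coboundaries of bounded cochains, as a subspace of `B^n(K)`. -/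
noncomputable def boundedCoboundaries (K : SSet.{u}) :
    (n : ℕ) → Submodule ℝ (BoundedCochain K n)
  | 0 => ⊥
  | n + 1 => LinearMap.range (boundedCoboundary K n)

/-- The bounded cohomology space of `K` in degree `n`: bounded cocycles modulo coboundaries of
bounded cochains. It carries the quotient semi-norm: the semi-norm of a class is the infimum of the
supremum norms of the bounded cocycles representing it. -/
abbrev BoundedCohomology (K : SSet.{u}) (n : ℕ) : Type u :=
  boundedCocycles K n ⧸ (boundedCoboundaries K n).submoduleOf (boundedCocycles K n)

theorem boundedCochainMap_mem_cocycles {K L : SSet.{u}} (f : K ⟶ L) (n : ℕ) :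
    ∀ c ∈ boundedCocycles L n, boundedCochainMap f n c ∈ boundedCocycles K n := by
  intro c hc
  rw [LinearMap.mem_ker] at hc ⊢
  rw [boundedCoboundary_map, hc, map_zero]

theorem boundedCochainMap_mem_coboundaries {K L : SSet.{u}} (f : K ⟶ L) (n : ℕ) :
    ∀ c ∈ boundedCoboundaries L n, boundedCochainMap f n c ∈ boundedCoboundaries K n := by
  cases n with
  | zero =>
    intro c hc
    have h : c = 0 := hc
    rw [h, map_zero]
    exact Submodule.zero_mem _
  | succ n =>
    rintro _ ⟨b, rfl⟩
    exact ⟨boundedCochainMap f n b, boundedCoboundary_map f n b⟩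

/-- The map in bounded cohomology induced by a simplicial map `f : K ⟶ L`. -/
noncomputable def boundedCohomologyMap {K L : SSet.{u}} (f : K ⟶ L) (n : ℕ) :
    BoundedCohomology L n →ₗ[ℝ] BoundedCohomology K n :=
  Submodule.mapQ _ _
    ((boundedCochainMap f n).restrict (boundedCochainMap_mem_cocycles f n))
    (fun c hc => boundedCochainMap_mem_coboundaries f n c hc)

/-! An abelian group is made to act transitively along the fibers of `p`, and bounded cochains of
`E` are averaged over it. With `n = k + 1`, a natural candidate is the group of `k`-cochains of `B`
with coefficients twisted by the bundle: over a simplex of `B`, the coboundary of such a cochain is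
a simplex of `K(π, n)`, by which the fiber can be translated. Changes of coordinates on fibers are
affine (`exists_affine`), so translations commute with the simplicial operators up to the
automorphisms `transport` of `π`. Every normalized cocycle of a standard simplex is a coboundary,
but a cochain of `B` cannot take independent values on faces that coincide in `B`, so this action
need not be transitive. Hence vertices are labelled by natural numbers and the cochains depend on
the labels: distinct non-zero labels tell all faces apart (`exists_labelledCocycle_eq`).

The group is abelian, hence has an invariant mean (`Mean.exists_invariant`); the labels are averaged
along an ultrafilter that is insensitive to the deletion of an entry. The mean of a cochain over the
translates of a simplex then depends only on the projection of the simplex to `B` (`fiberMean_eq`)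
and commutes with coboundaries (`sum_fiberMean_δ`). This gives a norm non-increasing cochain map
left inverse to `p^*`. Zero labels act trivially, so a prism with zero labels at the bottom and
generic labels at the top yields a bounded homotopy from the identity to the averaging on cocycles
(`coboundary_homotopy`). `isometric_of_transfer` concludes. -/

/-! ### Means -/

open Filter Topology in
/-- The limit of a function along an ultrafilter. -/
noncomputable def ultraLim {I : Type*} (U : Ultrafilter I) (f : I → ℝ) : ℝ :=
  limUnder (U : Filter I) f

section

open Filter Topology

theorem tendsto_ultraLim {I : Type*} (U : Ultrafilter I) {f : I → ℝ} {C : ℝ}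
    (hf : ∀ i, |f i| ≤ C) : Tendsto f U (𝓝 (ultraLim U f)) := by
  have hK : IsCompact (Set.Icc (-C) C) := isCompact_Icc
  obtain ⟨a, -, ha⟩ := hK.ultrafilter_le_nhds (U.map f)
    (by
      rw [Ultrafilter.coe_map, le_principal_iff, mem_map]
      exact Eventually.of_forall fun i => abs_le.1 (hf i))
  exact tendsto_nhds_limUnder ⟨a, ha⟩

theorem ultraLim_eq {I : Type*} (U : Ultrafilter I) {f : I → ℝ} {a : ℝ}
    (h : Tendsto f U (𝓝 a)) : ultraLim U f = a :=
  h.limUnder_eq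

theorem ultraLim_congr {I : Type*} (U : Ultrafilter I) {f g : I → ℝ}
    (h : ∀ᶠ i in (U : Filter I), f i = g i) : ultraLim U f = ultraLim U g := by
  unfold ultraLim limUnder
  rw [map_congr h]

theorem ultraLim_map {I J : Type*} (U : Ultrafilter I) (φ : I → J) (f : J → ℝ) :
    ultraLim (U.map φ) f = ultraLim U (fun i => f (φ i)) := by
  unfold ultraLim limUnder
  rw [Ultrafilter.coe_map, Filter.map_map]
  rfl

/-- Boundedness of a real function. -/
def Bdd {X : Type*} (f : X → ℝ) : Prop := ∃ C, ∀ x, |f x| ≤ C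

/-- A mean on `X`: a normalized functional on the bounded real functions on `X`, of norm at most
one. Its value on unbounded functions is irrelevant. -/
structure Mean (X : Type*) where
  toFun : (X → ℝ) → ℝ
  add' : ∀ f g, Bdd f → Bdd g → toFun (fun x => f x + g x) = toFun f + toFun g
  smul' : ∀ (r : ℝ) f, Bdd f → toFun (fun x => r * f x) = r * toFun f
  bound' : ∀ f C, (∀ x, |f x| ≤ C) → |toFun f| ≤ C
  const' : ∀ r, toFun (fun _ => r) = r

namespace Mean

instance (X : Type*) : CoeFun (Mean X) (fun _ => (X → ℝ) → ℝ) := ⟨Mean.toFun⟩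

variable {X Y : Type*}

theorem sum (M : Mean X) {ι : Type*} (s : Finset ι) (r : ι → ℝ) (f : ι → X → ℝ)
    (hf : ∀ i, Bdd (f i)) :
    M (fun x => ∑ i ∈ s, r i * f i x) = ∑ i ∈ s, r i * M (f i) := by
  classical
  suffices h : Bdd (fun x => ∑ i ∈ s, r i * f i x) ∧
      M (fun x => ∑ i ∈ s, r i * f i x) = ∑ i ∈ s, r i * M (f i) from h.2
  induction s using Finset.induction_on with
  | empty => exact ⟨⟨0, by simp⟩, by simpa using M.const' 0⟩
  | insert a s ha ih =>
    obtain ⟨⟨C, hC⟩, h⟩ := ih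
    obtain ⟨D, hD⟩ := hf a
    have hr : ∀ x, |r a * f a x| ≤ |r a| * D := fun x => by
      rw [abs_mul]; exact mul_le_mul_of_nonneg_left (hD x) (abs_nonneg _)
    simp only [Finset.sum_insert ha]
    refine ⟨⟨|r a| * D + C, fun x => (abs_add_le _ _).trans (add_le_add (hr x) (hC x))⟩, ?_⟩
    rw [M.add' _ _ ⟨_, hr⟩ ⟨C, hC⟩, M.smul' _ _ (hf a), h]

/-- The limit of means along an ultrafilter. -/
noncomputable def lim {I : Type*} (U : Ultrafilter I) (M : I → Mean X) : Mean X where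
  toFun f := ultraLim U (fun i => M i f)
  add' f g := by
    rintro ⟨C, hC⟩ ⟨D, hD⟩
    simp only [fun i => (M i).add' f g ⟨C, hC⟩ ⟨D, hD⟩]
    exact ultraLim_eq U ((tendsto_ultraLim U fun i => (M i).bound' f C hC).add
      (tendsto_ultraLim U fun i => (M i).bound' g D hD))
  smul' r f := by
    rintro ⟨C, hC⟩
    simp only [fun i => (M i).smul' r f ⟨C, hC⟩]
    exact ultraLim_eq U ((tendsto_ultraLim U fun i => (M i).bound' f C hC).const_mul r)
  bound' f C hC := by
    have h := (tendsto_ultraLim U fun i => (M i).bound' f C hC).abs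
    exact le_of_tendsto' h fun i => (M i).bound' f C hC
  const' r := by
    simp only [fun i => (M i).const' r]
    exact ultraLim_eq U tendsto_const_nhds

/-- The push-forward of a mean. -/
def map (M : Mean X) (φ : X → Y) : Mean Y where
  toFun f := M (fun x => f (φ x))
  add' f g := by
    rintro ⟨C, hC⟩ ⟨D, hD⟩
    exact M.add' _ _ ⟨C, fun _ => hC _⟩ ⟨D, fun _ => hD _⟩
  smul' r f := by
    rintro ⟨C, hC⟩
    exact M.smul' _ _ ⟨C, fun _ => hC _⟩
  bound' f C hC := M.bound' _ C fun _ => hC _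
  const' r := M.const' r

/-- The average over a finite family of points. -/
noncomputable def average {ι : Type*} [Fintype ι] [Nonempty ι] (v : ι → X) : Mean X where
  toFun f := (∑ i, f (v i)) / Fintype.card ι
  add' f g _ _ := by rw [Finset.sum_add_distrib, add_div]
  smul' r f _ := by rw [← Finset.mul_sum, mul_div_assoc]
  bound' f C hC := by
    have hpos : (0 : ℝ) < Fintype.card ι := by exact_mod_cast Fintype.card_pos
    rw [abs_div, abs_of_pos hpos, div_le_iff₀ hpos]
    refine (Finset.abs_sum_le_sum_abs _ _).trans ?_
    refine (Finset.sum_le_sum fun i _ => hC (v i)).trans ?_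
    simp [mul_comm]
  const' r := by
    have hpos : (Fintype.card ι : ℝ) ≠ 0 := by exact_mod_cast Fintype.card_ne_zero
    simp [hpos]

open scoped Classical in
/-- The average over the box of all combinations of the elements of `T` with coefficients at most
`N`. -/
noncomputable def boxAverage {G : Type*} [AddCommGroup G] (T : Finset G) (N : ℕ) : Mean G :=
  average (fun v : T → Fin (N + 1) => ∑ t : T, (v t : ℕ) • (t : G))

-- Along each line of the box in direction `t` the difference telescopes, leaving two boundary terms
-- out of `N + 1`.
open scoped Classical in
theorem boxAverage_translate {G : Type*} [AddCommGroup G] (T : Finset G) (N : ℕ) {t : G}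
    (ht : t ∈ T) {f : G → ℝ} {C : ℝ} (hf : ∀ x, |f x| ≤ C) :
    |boxAverage T N (fun x => f (x + t)) - boxAverage T N f| ≤ 2 * C / (N + 1) := by
  set t' : T := ⟨t, ht⟩
  have hpos : (0 : ℝ) < N + 1 := by positivity
  set S : ({j : T // j ≠ t'} → Fin (N + 1)) → G := fun w => ∑ j, (w j : ℕ) • (j.1 : G)
  have key : ∀ F : G → ℝ, boxAverage T N F =
      (∑ w : {j : T // j ≠ t'} → Fin (N + 1), ∑ i : Fin (N + 1), F ((i : ℕ) • t + S w)) /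
        ((N + 1) * Fintype.card ({j : T // j ≠ t'} → Fin (N + 1))) := by
    intro F
    have hcard : (Fintype.card (T → Fin (N + 1)) : ℝ) =
        (N + 1) * Fintype.card ({j : T // j ≠ t'} → Fin (N + 1)) := by
      rw [Fintype.card_congr (Equiv.funSplitAt t' (Fin (N + 1))), Fintype.card_prod]
      simp
    change (∑ v : T → Fin (N + 1), F (∑ t : T, (v t : ℕ) • (t : G))) / _ = _
    rw [hcard]
    congr 1
    rw [← (Equiv.funSplitAt t' (Fin (N + 1))).symm.sum_comp, Fintype.sum_prod_type,
      Finset.sum_comm]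
    refine Finset.sum_congr rfl fun w _ => Finset.sum_congr rfl fun i _ => ?_
    congr 1
    rw [Fintype.sum_eq_add_sum_subtype_ne _ t']
    congr 1
    · simp [t']
    · refine Finset.sum_congr rfl fun j _ => ?_
      have := j.2
      simp [this]
  rw [key, key, ← sub_div, abs_div]
  set L : ℝ := (Fintype.card ({j : T // j ≠ t'} → Fin (N + 1)) : ℝ)
  have hL : 0 < L := by
    simp only [L]
    exact_mod_cast Fintype.card_pos
  rw [abs_of_pos (mul_pos hpos hL), div_le_div_iff₀ (mul_pos hpos hL) hpos]
  have : |∑ w : {j : T // j ≠ t'} → Fin (N + 1), ∑ i : Fin (N + 1), f ((i : ℕ) • t + S w + t) -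
      ∑ w : {j : T // j ≠ t'} → Fin (N + 1), ∑ i : Fin (N + 1), f ((i : ℕ) • t + S w)| ≤
      L * (2 * C) := by
    rw [← Finset.sum_sub_distrib]
    refine (Finset.abs_sum_le_sum_abs _ _).trans ?_
    refine (Finset.sum_le_sum (g := fun _ => 2 * C) fun w _ => ?_).trans (by simp [L])
    rw [← Finset.sum_sub_distrib,
      Fin.sum_univ_eq_sum_range (fun i => f (i • t + S w + t) - f (i • t + S w))]
    have h1 : ∀ i : ℕ, f (i • t + S w + t) = f ((i + 1) • t + S w) := fun i => by
      rw [succ_nsmul, add_right_comm]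
    simp only [h1]
    rw [Finset.sum_range_sub (fun i => f (i • t + S w))]
    refine (abs_sub _ _).trans ?_
    linarith [hf ((N + 1) • t + S w), hf (0 • t + S w)]
  nlinarith

/-- Abelian groups are amenable. -/
theorem exists_invariant (G : Type*) [AddCommGroup G] :
    ∃ M : Mean G, ∀ (t : G) (f : G → ℝ), Bdd f → M (fun x => f (x + t)) = M f := by
  classical
  -- Along this ultrafilter the finite set eventually contains any given `t`, while `N` tends to
  -- infinity and kills the defect of invariance.
  let U : Ultrafilter (Finset G × ℕ) := Ultrafilter.of atTop
  refine ⟨lim U fun i => boxAverage i.1 i.2, ?_⟩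
  rintro t f ⟨C, hC⟩
  have h1 := tendsto_ultraLim U (f := fun i : Finset G × ℕ => boxAverage i.1 i.2 f)
    fun i => Mean.bound' _ f C hC
  have h2 : Tendsto (fun i : Finset G × ℕ => boxAverage i.1 i.2 (fun x => f (x + t)) -
      boxAverage i.1 i.2 f) U (𝓝 0) := by
    have h3 : Tendsto (fun i : Finset G × ℕ => 2 * C / ((i.2 : ℝ) + 1)) U (𝓝 0) := by
      have h5 : Tendsto (fun N : ℕ => 2 * C / ((N : ℝ) + 1)) atTop (𝓝 0) :=
        tendsto_const_nhds.div_atTop (tendsto_natCast_atTop_atTop.atTop_add tendsto_const_nhds)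
      have h4 : Tendsto (Prod.snd : Finset G × ℕ → ℕ) U atTop := by
        refine Tendsto.mono_left ?_ (Ultrafilter.of_le _)
        rw [← prod_atTop_atTop_eq]
        exact tendsto_snd
      exact h5.comp h4
    refine squeeze_zero_norm' ?_ h3
    have h6 : ∀ᶠ i : Finset G × ℕ in (U : Filter _), ({t}, 0) ≤ i :=
      Ultrafilter.of_le atTop (eventually_ge_atTop _)
    filter_upwards [h6] with i hi
    exact boxAverage_translate i.1 i.2 (by simpa using hi.1) hC
  have h7 := h2.add h1
  simp only [sub_add_cancel, zero_add] at h7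
  exact ultraLim_eq U h7

end Mean

/-! ### Generic labels -/

/-- An ultrafilter on the sequences of `k` natural numbers, concentrated on the sequences of
distinct non-zero numbers, and compatible with the deletion of entries. -/
noncomputable def labelFilter : (k : ℕ) → Ultrafilter (Fin k → ℕ)
  | 0 => pure Fin.elim0
  | k + 1 => (hyperfilter ℕ).bind fun a =>
    (labelFilter k).map fun s => (Fin.cons a s : Fin (k + 1) → ℕ)

theorem eventually_labelFilter_succ {k : ℕ} {P : (Fin (k + 1) → ℕ) → Prop} :
    (∀ᶠ s in (labelFilter (k + 1) : Filter _), P s) ↔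
      ∀ᶠ a in (hyperfilter ℕ : Filter ℕ), ∀ᶠ s in (labelFilter k : Filter _),
        P (Fin.cons a s : Fin (k + 1) → ℕ) :=
  Iff.rfl

theorem eventually_labelFilter_ne (k a : ℕ) :
    ∀ᶠ s in (labelFilter k : Filter (Fin k → ℕ)), ∀ i, s i ≠ a := by
  induction k with
  | zero => exact Eventually.of_forall fun s i => i.elim0
  | succ k ih =>
    rw [eventually_labelFilter_succ]
    have h : ∀ᶠ b in (hyperfilter ℕ : Filter ℕ), b ≠ a :=
      hyperfilter_le_cofinite (Set.finite_singleton a).compl_mem_cofinite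
    filter_upwards [h] with b hb
    filter_upwards [ih] with s hs i
    refine Fin.cases ?_ (fun i => ?_) i
    · simpa using hb
    · simpa using hs i

theorem eventually_labelFilter_injective (k : ℕ) :
    ∀ᶠ s in (labelFilter k : Filter (Fin k → ℕ)), Function.Injective s := by
  induction k with
  | zero => exact Eventually.of_forall fun s i => i.elim0
  | succ k ih =>
    rw [eventually_labelFilter_succ]
    refine Eventually.of_forall fun a => ?_
    filter_upwards [ih, eventually_labelFilter_ne k a] with s hs hsa
    rw [Fin.cons_injective_iff]
    exact ⟨by rintro ⟨i, hi⟩; exact hsa i hi, hs⟩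

/-- The filter is an iterated quantifier "for almost all". Deleting the first entry makes the outer
quantifier vacuous; deleting a later one happens under it, by induction. -/
theorem eventually_labelFilter_succAbove {k : ℕ} (i : Fin (k + 1)) {P : (Fin k → ℕ) → Prop} :
    (∀ᶠ s in (labelFilter (k + 1) : Filter _), P (s ∘ i.succAbove)) ↔
      ∀ᶠ s in (labelFilter k : Filter _), P s := by
  induction k with
  | zero =>
    have h : ∀ s : Fin 0 → ℕ, P s ↔ P Fin.elim0 := fun s => by
      rw [Subsingleton.elim s Fin.elim0]
    simp only [h]
    simp
  | succ k ih =>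
    rw [eventually_labelFilter_succ]
    refine Fin.cases ?_ (fun i => ?_) i
    · have h : ∀ (a : ℕ) (s : Fin (k + 1) → ℕ),
          (Fin.cons a s : Fin (k + 2) → ℕ) ∘ Fin.succAbove 0 = s := fun a s => by
        ext j; simp
      simp only [h]
      simp
    · have h : ∀ (a : ℕ) (s : Fin (k + 1) → ℕ),
          (Fin.cons a s : Fin (k + 2) → ℕ) ∘ Fin.succAbove i.succ =
            Fin.cons a (s ∘ i.succAbove) := fun a s => by
        ext j
        refine Fin.cases ?_ (fun j => ?_) j <;> simp
      simp only [h]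
      rw [eventually_labelFilter_succ]
      refine eventually_congr (Eventually.of_forall fun a => ?_)
      exact ih i (P := fun s => P (Fin.cons a s))

theorem labelFilter_map_succAbove {k : ℕ} (i : Fin (k + 1)) :
    (labelFilter (k + 1)).map (fun s => s ∘ i.succAbove) = labelFilter k :=
  Ultrafilter.ext fun _ => eventually_labelFilter_succAbove i

end

/-! ### Isometric isomorphisms in bounded cohomology -/

section

open Simplicial

theorem norm_boundedCochainMap_le {K L : SSet.{u}} (f : K ⟶ L) (m : ℕ) (c : BoundedCochain L m) :
    ‖boundedCochainMap f m c‖ ≤ ‖c‖ :=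
  lp.norm_le_of_forall_le (norm_nonneg c) fun σ =>
    lp.norm_apply_le_norm (E := fun _ : L _⦋m⦌ => ℝ) ENNReal.top_ne_zero c (f.app _ σ)

theorem boundedCohomologyMap_mk {K L : SSet.{u}} (f : K ⟶ L) (m : ℕ) (c : boundedCocycles L m) :
    boundedCohomologyMap f m (Submodule.Quotient.mk c) =
      Submodule.Quotient.mk ⟨boundedCochainMap f m c, boundedCochainMap_mem_cocycles f m c c.2⟩ :=
  rfl

theorem boundedCohomology_mk_eq_iff {K : SSet.{u}} {m : ℕ} {c d : boundedCocycles K m} :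
    (Submodule.Quotient.mk c : BoundedCohomology K m) = Submodule.Quotient.mk d ↔
      (c : BoundedCochain K m) - d ∈ boundedCoboundaries K m := by
  rw [Submodule.Quotient.eq]
  rfl

/-- Both `p^*` and `A` are norm non-increasing and they induce mutually inverse maps in cohomology,
so neither can decrease the semi-norm. -/
theorem isometric_of_transfer {E B : SSet.{u}} (p : E ⟶ B)
    (A : ∀ m, BoundedCochain E m →ₗ[ℝ] BoundedCochain B m)
    (hA : ∀ m c, boundedCoboundary B m (A m c) = A (m + 1) (boundedCoboundary E m c))
    (hnorm : ∀ m c, ‖A m c‖ ≤ ‖c‖)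
    (hleft : ∀ m c, A m (boundedCochainMap p m c) = c)
    (hright : ∀ m, ∀ c ∈ boundedCocycles E m,
      boundedCochainMap p m (A m c) - c ∈ boundedCoboundaries E m) (m : ℕ) :
    Function.Bijective (boundedCohomologyMap p m) ∧
      ∀ x : BoundedCohomology B m, ‖boundedCohomologyMap p m x‖ = ‖x‖ := by
  have hcoc : ∀ c ∈ boundedCocycles E m, A m c ∈ boundedCocycles B m := fun c hc => by
    rw [LinearMap.mem_ker] at hc ⊢
    rw [hA, hc, map_zero]
  have hcob : ∀ c ∈ boundedCoboundaries E m, A m c ∈ boundedCoboundaries B m := by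
    cases m with
    | zero =>
      intro c hc
      have h : c = 0 := hc
      rw [h, map_zero]
      exact Submodule.zero_mem _
    | succ m =>
      rintro _ ⟨b, rfl⟩
      exact ⟨A m b, hA m b⟩
  have hinj : Function.Injective (boundedCohomologyMap p m) := by
    intro x y hxy
    obtain ⟨b, rfl⟩ := Submodule.Quotient.mk_surjective _ x
    obtain ⟨d, rfl⟩ := Submodule.Quotient.mk_surjective _ y
    rw [boundedCohomologyMap_mk, boundedCohomologyMap_mk, boundedCohomology_mk_eq_iff] at hxy
    rw [boundedCohomology_mk_eq_iff]
    have h := hcob _ hxy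
    rwa [map_sub, hleft, hleft] at h
  have hmk : ∀ c : boundedCocycles E m, boundedCohomologyMap p m
      (Submodule.Quotient.mk ⟨A m c, hcoc c c.2⟩) = Submodule.Quotient.mk c := fun c => by
    rw [boundedCohomologyMap_mk, boundedCohomology_mk_eq_iff]
    exact hright m c c.2
  refine ⟨⟨hinj, fun y => ?_⟩, fun x => le_antisymm ?_ ?_⟩
  · obtain ⟨c, rfl⟩ := Submodule.Quotient.mk_surjective _ y
    exact ⟨_, hmk c⟩
  · refine le_of_forall_pos_le_add fun ε hε => ?_
    obtain ⟨b, rfl, hb⟩ := Submodule.Quotient.norm_mk_lt x hε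
    rw [boundedCohomologyMap_mk]
    exact (Submodule.Quotient.norm_mk_le _ _).trans
      ((norm_boundedCochainMap_le p m b).trans hb.le)
  · refine le_of_forall_pos_le_add fun ε hε => ?_
    obtain ⟨c, hc, hlt⟩ := Submodule.Quotient.norm_mk_lt (boundedCohomologyMap p m x) hε
    have hx : Submodule.Quotient.mk ⟨A m c, hcoc c c.2⟩ = x := hinj ((hmk c).trans hc)
    rw [← hx] at hlt ⊢
    exact (Submodule.Quotient.norm_mk_le _ _).trans ((hnorm m c).trans hlt.le)

/-! ### The prism identity -/

/-- Here `D i j` stands for the value on the `i`-th face of the `j`-th simplex of a prism, and `R i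
j` for the value on the `j`-th simplex of the prism over the `i`-th face. Interior walls cancel in
pairs by `h3`, and the two ends survive. -/
theorem sum_prism_nat (m : ℕ) (D R : ℕ → ℕ → ℝ)
    (h1 : ∀ i j, i ≤ j → j < m → D i (j + 1) = R i j)
    (h2 : ∀ i j, j < i → i < m + 1 → D (i + 1) j = R i j)
    (h3 : ∀ j, j < m → D (j + 1) (j + 1) = D (j + 1) j) :
    ∑ j ∈ Finset.range (m + 1), ∑ i ∈ Finset.range (m + 2), (-1) ^ (i + j) * D i j =
      D 0 0 - D (m + 1) m -
        ∑ j ∈ Finset.range m, ∑ i ∈ Finset.range (m + 1), (-1) ^ (i + j) * R i j := by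
  have hsq : ∀ j : ℕ, (-1 : ℝ) ^ (j + j) = 1 := fun j => by rw [← two_mul, pow_mul]; simp
  have split : ∀ j ∈ Finset.range (m + 1),
      ∑ i ∈ Finset.range (m + 2), (-1) ^ (i + j) * D i j =
        (∑ i ∈ Finset.range j, (-1) ^ (i + j) * D i j) + (D j j - D (j + 1) j) +
          ∑ i ∈ Finset.Ico (j + 1) (m + 1), (-1) ^ (i + 1 + j) * D (i + 1) j := by
    intro j hj
    have hj' : j + 2 ≤ m + 2 := by have := Finset.mem_range.1 hj; omega
    rw [← Finset.sum_range_add_sum_Ico _ hj', Finset.sum_range_succ, Finset.sum_range_succ, hsq,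
      ← Finset.sum_Ico_add' (fun i => (-1 : ℝ) ^ (i + j) * D i j) (j + 1) (m + 1) 1,
      add_right_comm j 1 j, pow_succ, hsq]
    ring
  have splitR : ∀ j ∈ Finset.range m, ∑ i ∈ Finset.range (m + 1), (-1) ^ (i + j) * R i j =
      -(∑ i ∈ Finset.range (j + 1), (-1) ^ (i + (j + 1)) * D i (j + 1)) -
        ∑ i ∈ Finset.Ico (j + 1) (m + 1), (-1) ^ (i + 1 + j) * D (i + 1) j := by
    intro j hj
    have hj' := Finset.mem_range.1 hj
    rw [← Finset.sum_range_add_sum_Ico _ (show j + 1 ≤ m + 1 by omega), sub_eq_add_neg,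
      ← Finset.sum_neg_distrib, ← Finset.sum_neg_distrib]
    refine congrArg₂ _ (Finset.sum_congr rfl fun i hi => ?_)
      (Finset.sum_congr rfl fun i hi => ?_)
    · rw [h1 i j (by have := Finset.mem_range.1 hi; omega) hj']
      ring
    · have := Finset.mem_Ico.1 hi
      rw [h2 i j (by omega) (by omega)]
      ring
  rw [Finset.sum_congr rfl split, Finset.sum_congr rfl splitR, Finset.sum_add_distrib,
    Finset.sum_add_distrib, Finset.sum_sub_distrib (fun j => -∑ i ∈ Finset.range (j + 1), _),
    Finset.sum_neg_distrib]
  rw [Finset.sum_range_succ' (fun j => ∑ i ∈ Finset.range j, (-1) ^ (i + j) * D i j),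
    Finset.sum_range_succ (fun j => D j j - D (j + 1) j),
    Finset.sum_range_succ (fun j => ∑ i ∈ Finset.Ico (j + 1) (m + 1), _)]
  have htel : ∑ j ∈ Finset.range m, (D j j - D (j + 1) j) = D 0 0 - D m m := by
    rw [← Finset.sum_range_sub' (fun j => D j j)]
    exact Finset.sum_congr rfl fun j hj => by rw [h3 j (Finset.mem_range.1 hj)]
  rw [htel]
  simp
  ring

theorem sum_prism (m : ℕ) (D : Fin (m + 3) → Fin (m + 2) → ℝ) (R : Fin (m + 2) → Fin (m + 1) → ℝ)
    (h1 : ∀ i j, i ≤ j.castSucc → D i.castSucc j.succ = R i j)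
    (h2 : ∀ i j, j.castSucc < i → D i.succ j.castSucc = R i j)
    (h3 : ∀ j : Fin (m + 1), D j.castSucc.succ j.succ = D j.castSucc.succ j.castSucc) :
    ∑ j : Fin (m + 2), ∑ i : Fin (m + 3), (-1) ^ ((i : ℕ) + (j : ℕ)) * D i j =
      D 0 0 - D (Fin.last _) (Fin.last _) -
        ∑ j : Fin (m + 1), ∑ i : Fin (m + 2), (-1) ^ ((i : ℕ) + (j : ℕ)) * R i j := by
  -- Extension by zero; only indices in range enter the sums.
  let D' : ℕ → ℕ → ℝ := fun i j =>
    if h : i < m + 3 ∧ j < m + 2 then D ⟨i, h.1⟩ ⟨j, h.2⟩ else 0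
  let R' : ℕ → ℕ → ℝ := fun i j =>
    if h : i < m + 2 ∧ j < m + 1 then R ⟨i, h.1⟩ ⟨j, h.2⟩ else 0
  have hD : ∀ i j, D i j = D' i j := fun i j => by
    simp only [D']
    rw [dif_pos ⟨i.2, j.2⟩]
  have hR : ∀ i j, R i j = R' i j := fun i j => by
    simp only [R']
    rw [dif_pos ⟨i.2, j.2⟩]
  have h := sum_prism_nat (m + 1) D' R' (fun i j hij hj => ?_) (fun i j hij hi => ?_)
    (fun j hj => ?_)
  · simp only [hD, hR]
    simp only [Finset.sum_range] at h
    exact h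
  · have hi : i < m + 2 := by omega
    simpa [hD, hR] using h1 ⟨i, hi⟩ ⟨j, hj⟩ hij
  · have hj : j < m + 1 := by omega
    simpa [hD, hR] using h2 ⟨i, hi⟩ ⟨j, hj⟩ hij
  · simpa [hD] using h3 ⟨j, hj⟩

/-! ### Fiberwise actions and averaging -/

theorem coe_succAbove {k : ℕ} (i : Fin (k + 1)) (a : Fin k) :
    (i.succAbove a : ℕ) = if (a : ℕ) < i then (a : ℕ) else a + 1 := by
  simp only [Fin.succAbove, Fin.lt_def, Fin.val_castSucc]
  split_ifs <;> simp

/-- A family of actions of an abelian group `G` on the simplices of `E` along the fibers of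
`p : E ⟶ B`, depending on a labelling of the vertices by natural numbers, compatible with the
simplicial operators, trivial for the zero labels, and transitive on the fibers for generic
labels. -/
structure LabelledAction {E B : SSet.{u}} (p : E ⟶ B) (G : Type*) [AddCommGroup G] where
  act {m : ℕ} (g : G) (e : E _⦋m⦌) (s : Fin (m + 1) → ℕ) : E _⦋m⦌
  proj_act {m : ℕ} (g : G) (e : E _⦋m⦌) (s : Fin (m + 1) → ℕ) :
    p.app _ (act g e s) = p.app _ e
  add_act {m : ℕ} (g h : G) (e : E _⦋m⦌) (s : Fin (m + 1) → ℕ) :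
    act (g + h) e s = act g (act h e s) s
  act_zero {m : ℕ} (g : G) (e : E _⦋m⦌) : act g e (fun _ => 0) = e
  map_act {m r : ℕ} (θ : ⦋r⦌ ⟶ ⦋m⦌) (g : G) (e : E _⦋m⦌) (s : Fin (m + 1) → ℕ) :
    E.map θ.op (act g e s) = act g (E.map θ.op e) (s ∘ θ.toOrderHom)
  exists_act_eq {m : ℕ} (e e' : E _⦋m⦌) (s : Fin (m + 1) → ℕ) (hs : Function.Injective s)
    (hs0 : ∀ i, s i ≠ 0) (h : p.app _ e = p.app _ e') : ∃ g, act g e s = e'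

/-- The mean over an abelian group and generic labels. -/
noncomputable def labelMean {G : Type*} (M : Mean G) (k : ℕ) : Mean (G × (Fin k → ℕ)) :=
  Mean.lim (labelFilter k) fun s => M.map fun g => (g, s)

/-- This is what lets averaging commute with faces: a face forgets one label, and the label
ultrafilter does not notice. -/
theorem labelMean_succAbove {G : Type*} (M : Mean G) {k : ℕ} (i : Fin (k + 1))
    (f : G × (Fin k → ℕ) → ℝ) :
    labelMean M (k + 1) (fun x => f (x.1, x.2 ∘ i.succAbove)) = labelMean M k f := by
  change ultraLim (labelFilter (k + 1)) (fun s => M fun g => f (g, s ∘ i.succAbove)) =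
    ultraLim (labelFilter k) (fun s => M fun g => f (g, s))
  rw [← labelFilter_map_succAbove i, ultraLim_map]

theorem abs_boundedCochain_le {K : SSet.{u}} {m : ℕ} (c : BoundedCochain K m) (σ : K _⦋m⦌) :
    |c.1 σ| ≤ ‖c‖ :=
  lp.norm_apply_le_norm (E := fun _ : K _⦋m⦌ => ℝ) ENNReal.top_ne_zero c σ

theorem coboundary_apply {K : SSet.{u}} {m : ℕ} (c : K _⦋m⦌ → ℝ) (σ : K _⦋m + 1⦌) :
    coboundary K m c σ = ∑ i : Fin (m + 2), (-1 : ℝ) ^ (i : ℕ) * c (K.δ i σ) := by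
  change ∑ i : Fin (m + 2), (-1 : ℤ) ^ (i : ℕ) • c (K.δ i σ) = _
  simp

theorem coboundary_eq_zero_of_mem {K : SSet.{u}} {m : ℕ} {c : BoundedCochain K m}
    (hc : c ∈ boundedCocycles K m) : coboundary K m c.1 = 0 :=
  congrArg Subtype.val (LinearMap.mem_ker.1 hc)

namespace LabelledAction

variable {E B : SSet.{u}} {p : E ⟶ B} {G : Type*} [AddCommGroup G] (Φ : LabelledAction p G)
  (M : Mean G)

theorem δ_act {m : ℕ} (i : Fin (m + 2)) (g : G) (e : E _⦋m + 1⦌) (s : Fin (m + 2) → ℕ) :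
    E.δ i (Φ.act g e s) = Φ.act g (E.δ i e) (s ∘ i.succAbove) :=
  Φ.map_act (SimplexCategory.δ i) g e s

/-- The average of a cochain of the total space over the translates of a simplex. -/
noncomputable def fiberMean {m : ℕ} (c : E _⦋m⦌ → ℝ) (e : E _⦋m⦌) : ℝ :=
  labelMean M (m + 1) fun x => c (Φ.act x.1 e x.2)

theorem abs_fiberMean_le {m : ℕ} {c : E _⦋m⦌ → ℝ} {C : ℝ} (hc : ∀ e, |c e| ≤ C) (e : E _⦋m⦌) :
    |Φ.fiberMean M c e| ≤ C :=
  Mean.bound' _ _ _ fun _ => hc _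

/-- For generic labels `e'` is a translate of `e` by some group element, which the invariance of `M`
absorbs. That element may vary with the labels. -/
theorem fiberMean_eq (hM : ∀ (t : G) (f : G → ℝ), Bdd f → M (fun x => f (x + t)) = M f)
    {m : ℕ} {c : E _⦋m⦌ → ℝ} {C : ℝ} (hc : ∀ e, |c e| ≤ C) (e e' : E _⦋m⦌)
    (h : p.app _ e = p.app _ e') : Φ.fiberMean M c e = Φ.fiberMean M c e' := by
  change ultraLim (labelFilter (m + 1)) (fun s => M fun g => c (Φ.act g e s)) =
    ultraLim (labelFilter (m + 1)) (fun s => M fun g => c (Φ.act g e' s))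
  refine ultraLim_congr _ ?_
  filter_upwards [eventually_labelFilter_injective (m + 1), eventually_labelFilter_ne (m + 1) 0]
    with s hs hs0
  obtain ⟨g, rfl⟩ := Φ.exists_act_eq e e' s hs hs0 h
  simp only [← Φ.add_act]
  exact (hM g (fun h => c (Φ.act h e s)) ⟨C, fun _ => hc _⟩).symm

theorem sum_fiberMean_δ {m : ℕ} {c : E _⦋m⦌ → ℝ} {C : ℝ} (hc : ∀ e, |c e| ≤ C)
    (e : E _⦋m + 1⦌) :
    ∑ i : Fin (m + 2), (-1 : ℝ) ^ (i : ℕ) * Φ.fiberMean M c (E.δ i e) =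
      Φ.fiberMean M (coboundary E m c) e := by
  unfold fiberMean
  simp only [coboundary_apply, δ_act]
  rw [Mean.sum _ _ (fun i : Fin (m + 2) => (-1 : ℝ) ^ (i : ℕ))
    (fun i (x : G × (Fin (m + 2) → ℕ)) => c (Φ.act x.1 (E.δ i e) (x.2 ∘ i.succAbove)))
    (fun i => ⟨C, fun _ => hc _⟩)]
  exact Finset.sum_congr rfl fun i _ => congrArg _ (labelMean_succAbove M i
    (fun x => c (Φ.act x.1 (E.δ i e) x.2))).symm

/-- The cochain map `B^*(E) ⟶ B^*(B)` given by averaging over the fibers. -/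
noncomputable def transfer (sec : ∀ m, B _⦋m⦌ → E _⦋m⦌) (m : ℕ) :
    BoundedCochain E m →ₗ[ℝ] BoundedCochain B m where
  toFun c := ⟨fun σ => Φ.fiberMean M c.1 (sec m σ), memℓp_infty ⟨‖c‖, by
    rintro _ ⟨σ, rfl⟩
    exact Φ.abs_fiberMean_le M (abs_boundedCochain_le c) _⟩⟩
  map_add' c d := Subtype.ext (funext fun σ =>
    Mean.add' (labelMean M (m + 1)) (fun x => c.1 (Φ.act x.1 (sec m σ) x.2))
      (fun x => d.1 (Φ.act x.1 (sec m σ) x.2)) ⟨‖c‖, fun _ => abs_boundedCochain_le c _⟩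
      ⟨‖d‖, fun _ => abs_boundedCochain_le d _⟩)
  map_smul' r c := Subtype.ext (funext fun σ =>
    Mean.smul' (labelMean M (m + 1)) r (fun x => c.1 (Φ.act x.1 (sec m σ) x.2))
      ⟨‖c‖, fun _ => abs_boundedCochain_le c _⟩)

/-- The labels of the vertices of the `j`-th simplex of a prism, zero on the bottom face. -/
def prismLabel {m : ℕ} (j : Fin (m + 1)) (s : Fin (m + 1) → ℕ) : Fin (m + 2) → ℕ :=
  -- Past the repeated vertex, vertex `i` of `E.σ j e` is vertex `i - 1` of `e`.
  fun i => if (i : ℕ) ≤ j then 0 else s ⟨i - 1, by omega⟩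

/-- The `j`-th simplex of the prism over `e`. -/
def prism {m : ℕ} (j : Fin (m + 1)) (g : G) (e : E _⦋m⦌) (s : Fin (m + 1) → ℕ) : E _⦋m + 1⦌ :=
  Φ.act g (E.σ j e) (prismLabel j s)

theorem prismLabel_succ_comp {m : ℕ} {i : Fin (m + 2)} {j : Fin (m + 1)} (h : i ≤ j.castSucc)
    (s : Fin (m + 2) → ℕ) :
    prismLabel j.succ s ∘ i.castSucc.succAbove = prismLabel j (s ∘ i.succAbove) := by
  ext a
  simp only [Fin.le_def, Fin.val_castSucc] at h
  simp only [prismLabel, Function.comp_apply]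
  split_ifs with h1 h2 h2
  · rfl
  · simp only [coe_succAbove, Fin.val_castSucc, Fin.val_succ] at h1 h2
    split_ifs at h1 <;> omega
  · simp only [coe_succAbove, Fin.val_castSucc, Fin.val_succ] at h1 h2
    split_ifs at h1 <;> omega
  · refine congrArg s (Fin.ext ?_)
    simp only [coe_succAbove, Fin.val_castSucc, Fin.val_succ] at h1 h2 ⊢
    split_ifs at h1 ⊢ <;> omega

theorem δ_prism_of_le {m : ℕ} {i : Fin (m + 2)} {j : Fin (m + 1)} (h : i ≤ j.castSucc) (g : G)
    (e : E _⦋m + 1⦌) (s : Fin (m + 2) → ℕ) :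
    E.δ i.castSucc (Φ.prism j.succ g e s) = Φ.prism j g (E.δ i e) (s ∘ i.succAbove) := by
  unfold prism
  rw [δ_act, SSet.δ_comp_σ_of_le_apply h, prismLabel_succ_comp h]

theorem prismLabel_castSucc_comp {m : ℕ} {i : Fin (m + 2)} {j : Fin (m + 1)}
    (h : j.castSucc < i) (s : Fin (m + 2) → ℕ) :
    prismLabel j.castSucc s ∘ i.succ.succAbove = prismLabel j (s ∘ i.succAbove) := by
  ext a
  simp only [Fin.lt_def, Fin.val_castSucc] at h
  simp only [prismLabel, Function.comp_apply]
  split_ifs with h1 h2 h2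
  · rfl
  · simp only [coe_succAbove, Fin.val_castSucc, Fin.val_succ] at h1 h2
    split_ifs at h1 <;> omega
  · simp only [coe_succAbove, Fin.val_castSucc, Fin.val_succ] at h1 h2
    split_ifs at h1 <;> omega
  · refine congrArg s (Fin.ext ?_)
    simp only [coe_succAbove, Fin.val_castSucc, Fin.val_succ] at h1 h2 ⊢
    split_ifs at h1 ⊢ <;> omega

theorem δ_prism_of_gt {m : ℕ} {i : Fin (m + 2)} {j : Fin (m + 1)} (h : j.castSucc < i) (g : G)
    (e : E _⦋m + 1⦌) (s : Fin (m + 2) → ℕ) :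
    E.δ i.succ (Φ.prism j.castSucc g e s) = Φ.prism j g (E.δ i e) (s ∘ i.succAbove) := by
  unfold prism
  rw [δ_act, SSet.δ_comp_σ_of_gt_apply h, prismLabel_castSucc_comp h]

theorem prismLabel_succ_comp_succ {m : ℕ} (j : Fin (m + 1)) (s : Fin (m + 2) → ℕ) :
    prismLabel j.succ s ∘ j.castSucc.succ.succAbove =
      prismLabel j.castSucc s ∘ j.castSucc.succ.succAbove := by
  ext a
  simp only [prismLabel, Function.comp_apply]
  split_ifs with h1 h2 h2
  · rfl
  · simp only [coe_succAbove, Fin.val_castSucc, Fin.val_succ] at h1 h2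
    split_ifs at h1 h2 <;> omega
  · simp only [coe_succAbove, Fin.val_castSucc, Fin.val_succ] at h1 h2
    split_ifs at h1 h2 <;> omega
  · rfl

/-- The wall shared by two consecutive simplices of the prism: the omitted vertex is the only one
whose label differs. -/
theorem δ_prism_succ {m : ℕ} (j : Fin (m + 1)) (g : G) (e : E _⦋m + 1⦌) (s : Fin (m + 2) → ℕ) :
    E.δ j.castSucc.succ (Φ.prism j.succ g e s) = E.δ j.castSucc.succ (Φ.prism j.castSucc g e s) := by
  unfold prism
  rw [δ_act, δ_act, SSet.δ_comp_σ_succ_apply, prismLabel_succ_comp_succ, Fin.succ_castSucc,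
    SSet.δ_comp_σ_self_apply]

theorem δ_zero_prism_zero {m : ℕ} (g : G) (e : E _⦋m⦌) (s : Fin (m + 1) → ℕ) :
    E.δ 0 (Φ.prism 0 g e s) = Φ.act g e s := by
  have h : prismLabel 0 s ∘ Fin.succAbove 0 = s := by
    ext a
    simp [prismLabel]
  have h1 := SSet.δ_comp_σ_self_apply (S := E) (0 : Fin (m + 1)) e
  rw [Fin.castSucc_zero] at h1
  unfold prism
  rw [δ_act, h1, h]

/-- The bottom of the prism carries only zero labels, so `act_zero` applies. -/
theorem δ_last_prism_last {m : ℕ} (g : G) (e : E _⦋m⦌) (s : Fin (m + 1) → ℕ) :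
    E.δ (Fin.last _) (Φ.prism (Fin.last _) g e s) = e := by
  have h : prismLabel (Fin.last m) s ∘ Fin.succAbove (Fin.last _) = fun _ => 0 := by
    ext a
    simp only [prismLabel, Function.comp_apply, coe_succAbove, Fin.val_last]
    split_ifs <;> first | rfl | omega
  have h1 := SSet.δ_comp_σ_succ_apply (S := E) (Fin.last m) e
  rw [Fin.succ_last] at h1
  unfold prism
  rw [δ_act, h1, h, act_zero]

theorem sum_prism_δ {m : ℕ} {c : E _⦋m + 1⦌ → ℝ} (hc : coboundary E (m + 1) c = 0)
    (g : G) (e : E _⦋m + 1⦌) (s : Fin (m + 2) → ℕ) :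
    ∑ j : Fin (m + 1), ∑ i : Fin (m + 2), (-1 : ℝ) ^ ((i : ℕ) + (j : ℕ)) *
      c (Φ.prism j g (E.δ i e) (s ∘ i.succAbove)) = c (Φ.act g e s) - c e := by
  have h := sum_prism m (fun i j => c (E.δ i (Φ.prism j g e s)))
    (fun i j => c (Φ.prism j g (E.δ i e) (s ∘ i.succAbove)))
    (fun i j hij => by rw [Φ.δ_prism_of_le hij]) (fun i j hij => by rw [Φ.δ_prism_of_gt hij])
    (fun j => by rw [Φ.δ_prism_succ])
  rw [Φ.δ_zero_prism_zero, Φ.δ_last_prism_last] at h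
  -- For each `j` the inner sum is, up to sign, the coboundary of the cocycle `c` on a prism
  -- simplex.
  have h0 : ∑ j : Fin (m + 2), ∑ i : Fin (m + 3), (-1 : ℝ) ^ ((i : ℕ) + (j : ℕ)) *
      c (E.δ i (Φ.prism j g e s)) = 0 := by
    refine Finset.sum_eq_zero fun j _ => ?_
    have h1 := coboundary_apply c (Φ.prism j g e s)
    rw [hc] at h1
    simp only [pow_add, mul_right_comm _ ((-1 : ℝ) ^ (j : ℕ)), ← Finset.sum_mul]
    rw [← h1]
    exact zero_mul _
  linarith

/-- The cochain homotopy between the identity and the averaging over the fibers. -/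
noncomputable def homotopy {m : ℕ} (c : E _⦋m + 1⦌ → ℝ) (e : E _⦋m⦌) : ℝ :=
  ∑ j : Fin (m + 1), (-1 : ℝ) ^ (j : ℕ) *
    labelMean M (m + 1) (fun x => c (Φ.prism j x.1 e x.2))

theorem abs_homotopy_le {m : ℕ} {c : E _⦋m + 1⦌ → ℝ} {C : ℝ} (hc : ∀ e, |c e| ≤ C)
    (e : E _⦋m⦌) : |Φ.homotopy M c e| ≤ ∑ _j : Fin (m + 1), C := by
  refine (Finset.abs_sum_le_sum_abs _ _).trans (Finset.sum_le_sum fun j _ => ?_)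
  rw [abs_mul, abs_pow, abs_neg, abs_one, one_pow, one_mul]
  exact Mean.bound' _ _ _ fun _ => hc _

/-- Apply the mean to `sum_prism_δ`; deletion invariance turns its left side into the coboundary of
the homotopy. -/
theorem coboundary_homotopy {m : ℕ} {c : E _⦋m + 1⦌ → ℝ} {C : ℝ} (hb : ∀ e, |c e| ≤ C)
    (hc : coboundary E (m + 1) c = 0) (e : E _⦋m + 1⦌) :
    coboundary E m (Φ.homotopy M c) e = Φ.fiberMean M c e - c e := by
  have h := Mean.sum (labelMean M (m + 2)) (Finset.univ : Finset (Fin (m + 1) × Fin (m + 2)))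
    (fun x => (-1 : ℝ) ^ ((x.2 : ℕ) + (x.1 : ℕ)))
    (fun x y => c (Φ.prism x.1 y.1 (E.δ x.2 e) (y.2 ∘ x.2.succAbove)))
    (fun x => ⟨C, fun _ => hb _⟩)
  simp only [Fintype.sum_prod_type] at h
  simp only [Φ.sum_prism_δ hc] at h
  have h2 := Mean.add' (labelMean M (m + 2)) (fun x => c (Φ.act x.1 e x.2)) (fun _ => -c e)
    ⟨C, fun _ => hb _⟩ ⟨_, fun _ => le_rfl⟩
  rw [Mean.const'] at h2
  simp only [← sub_eq_add_neg] at h2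
  rw [h2, Finset.sum_comm] at h
  refine Eq.trans ?_ h.symm
  rw [coboundary_apply]
  refine Finset.sum_congr rfl fun i _ => ?_
  unfold homotopy
  rw [Finset.mul_sum]
  refine Finset.sum_congr rfl fun j _ => ?_
  rw [← mul_assoc, ← pow_add]
  exact congrArg _ (labelMean_succAbove M i
    (fun x => c (Φ.prism j x.1 (E.δ i e) x.2))).symm

/-- In degree zero the prism is an edge from `e` to its translate, and a cocycle agrees at both
ends. -/
theorem fiberMean_of_coboundary_eq_zero {c : E _⦋0⦌ → ℝ} (hc : coboundary E 0 c = 0)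
    (e : E _⦋0⦌) : Φ.fiberMean M c e = c e := by
  have h : ∀ g s, c (Φ.act g e s) = c e := fun g s => by
    have h1 := coboundary_apply c (Φ.prism 0 g e s)
    rw [hc, Fin.sum_univ_two, Φ.δ_zero_prism_zero,
      show (1 : Fin 2) = Fin.last _ from rfl, show (0 : Fin 1) = Fin.last _ from rfl,
      Φ.δ_last_prism_last] at h1
    have h2 : (0 : ℝ) = c (Φ.act g e s) - c e := by
      simpa [sub_eq_add_neg] using h1
    linarith
  unfold fiberMean
  simp only [h]
  exact Mean.const' _ _

theorem isometric (Φ : LabelledAction p G) (hp : ∀ m (σ : B _⦋m⦌), ∃ e, p.app _ e = σ) (m : ℕ) :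
    Function.Bijective (boundedCohomologyMap p m) ∧
      ∀ x : BoundedCohomology B m, ‖boundedCohomologyMap p m x‖ = ‖x‖ := by
  obtain ⟨M, hM⟩ := Mean.exists_invariant G
  -- A mere set-theoretic section; it need not be simplicial, because `fiberMean` is constant on
  -- fibers.
  choose sec hsec using hp
  have hproj : ∀ m (c : BoundedCochain E m) e, Φ.fiberMean M c.1 (sec m (p.app _ e)) =
      Φ.fiberMean M c.1 e :=
    fun m c e => Φ.fiberMean_eq M hM (abs_boundedCochain_le c) _ _ (hsec m _)
  refine isometric_of_transfer p (Φ.transfer M sec) (fun m c => ?_) (fun m c => ?_)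
    (fun m c => ?_) (fun m c hc => ?_) m
  · refine Subtype.ext (funext fun σ => ?_)
    refine (coboundary_apply (Φ.transfer M sec m c).1 σ).trans ?_
    refine Eq.trans (Finset.sum_congr rfl fun i _ => congrArg _ ?_)
      (Φ.sum_fiberMean_δ M (abs_boundedCochain_le c) (sec (m + 1) σ))
    refine Φ.fiberMean_eq M hM (abs_boundedCochain_le c) _ _ ?_
    rw [hsec, SSet.δ_naturality_apply, hsec]
  · exact lp.norm_le_of_forall_le (norm_nonneg c) fun σ =>
      Φ.abs_fiberMean_le M (abs_boundedCochain_le c) _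
  · refine Subtype.ext (funext fun σ => ?_)
    change labelMean M (m + 1) (fun x => c.1 (p.app _ (Φ.act x.1 (sec m σ) x.2))) = _
    have h : ∀ x : G × (Fin (m + 1) → ℕ), c.1 (p.app _ (Φ.act x.1 (sec m σ) x.2)) = c.1 σ :=
      fun x => congrArg c.1 ((Φ.proj_act _ _ _).trans (hsec m σ))
    exact (congrArg _ (funext h)).trans (Mean.const' _ _)
  · have hc' := coboundary_eq_zero_of_mem hc
    cases m with
    | zero =>
      have h : boundedCochainMap p 0 (Φ.transfer M sec 0 c) - c = 0 := by
        refine sub_eq_zero.2 (Subtype.ext (funext fun e => ?_))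
        exact (hproj 0 c e).trans (Φ.fiberMean_of_coboundary_eq_zero M hc' e)
      rw [h]
      exact Submodule.zero_mem _
    | succ m =>
      refine ⟨⟨Φ.homotopy M c.1, memℓp_infty ⟨∑ _j : Fin (m + 1), ‖c‖, ?_⟩⟩, ?_⟩
      · rintro _ ⟨e, rfl⟩
        exact Φ.abs_homotopy_le M (abs_boundedCochain_le c) e
      · refine Subtype.ext (funext fun e => ?_)
        refine (Φ.coboundary_homotopy M (abs_boundedCochain_le c) hc' e).trans ?_
        exact congrArg (· - c.1 e) (hproj (m + 1) c e).symm

end LabelledAction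

end

section

open Simplicial Opposite SimplexCategory

/-! ### Alternating sums over the faces of a simplex of a standard simplex -/

section AlternatingSums

variable {A : Type*} [AddCommGroup A]

theorem not_injective_comp {a b c : SimplexCategory} (f : a ⟶ b) (g : b ⟶ c)
    (hf : ¬ Function.Injective f.toOrderHom) : ¬ Function.Injective (f ≫ g).toOrderHom := by
  intro h
  rw [SimplexCategory.comp_toOrderHom] at h
  exact hf (Function.Injective.of_comp (f := g.toOrderHom) h)

/-- Such a face keeps both vertices that `σ j` identifies. -/
theorem not_injective_δ_comp_σ {k : ℕ} {i : Fin (k + 2)} {j : Fin (k + 1)} (h1 : i ≠ j.castSucc)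
    (h2 : i ≠ j.succ) : ¬ Function.Injective (δ i ≫ σ j).toOrderHom := by
  obtain ⟨a, ha⟩ := Fin.exists_succAbove_eq h1.symm
  obtain ⟨b, hb⟩ := Fin.exists_succAbove_eq h2.symm
  intro h
  have hab : a = b := h (by
    change j.predAbove (i.succAbove a) = j.predAbove (i.succAbove b)
    rw [ha, hb, Fin.predAbove_castSucc_self, Fin.predAbove_succ_self])
  rw [hab, hb] at ha
  exact absurd ha (by simp [Fin.ext_iff])

theorem alternatingSum_σ {k : ℕ} (w : Fin (k + 2) → A) (j : Fin (k + 1))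
    (h : w j.castSucc = w j.succ) (h0 : ∀ i, i ≠ j.castSucc → i ≠ j.succ → w i = 0) :
    ∑ i : Fin (k + 2), (-1 : ℤ) ^ (i : ℕ) • w i = 0 := by
  have hne : j.castSucc ≠ j.succ := by simp [Fin.ext_iff]
  rw [Fintype.sum_eq_add j.castSucc j.succ hne fun i hi => by rw [h0 i hi.1 hi.2, smul_zero], h]
  simp [pow_succ]

theorem alternatingSum_δ_of_not_injective {k : ℕ} {r : SimplexCategory} {f : (⦋k⦌ ⟶ r) → A}
    (hf : ∀ τ : ⦋k⦌ ⟶ r, ¬ Function.Injective τ.toOrderHom → f τ = 0) (β : ⦋k + 1⦌ ⟶ r)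
    (hβ : ¬ Function.Injective β.toOrderHom) :
    ∑ i : Fin (k + 2), (-1 : ℤ) ^ (i : ℕ) • f (δ i ≫ β) = 0 := by
  obtain ⟨j, β', rfl⟩ := SimplexCategory.eq_σ_comp_of_not_injective β hβ
  refine alternatingSum_σ _ j ?_ fun i h1 h2 => ?_
  · rw [δ_comp_σ_self_assoc, δ_comp_σ_succ_assoc]
  · rw [← Category.assoc]
    exact hf _ (not_injective_comp _ _ (not_injective_δ_comp_σ h1 h2))

/-- The square of the coboundary vanishes: terms `(j, i)` with `j ≤ i` cancel against `(i + 1, j)`.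
-/
theorem alternatingSum_alternatingSum {k : ℕ} {r : SimplexCategory} (f : (⦋k⦌ ⟶ r) → A)
    (β : ⦋k + 2⦌ ⟶ r) :
    ∑ j : Fin (k + 3), (-1 : ℤ) ^ (j : ℕ) •
      ∑ i : Fin (k + 2), (-1 : ℤ) ^ (i : ℕ) • f (δ i ≫ δ j ≫ β) = 0 := by
  simp only [Finset.smul_sum, smul_smul, ← pow_add]
  rw [← Finset.sum_product']
  let P := Fin (k + 3) × Fin (k + 2)
  let S : Finset P := Finset.univ.filter fun ij => (ij.1 : ℕ) ≤ (ij.2 : ℕ)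
  rw [Finset.univ_product_univ, ← Finset.sum_add_sum_compl S, ← eq_neg_iff_add_eq_zero,
    ← Finset.sum_neg_distrib]
  let φ : ∀ ij : P, ij ∈ S → P := fun ij hij =>
    (ij.2.succ, Fin.castLT ij.1 (lt_of_le_of_lt (Finset.mem_filter.mp hij).right (Fin.is_lt ij.2)))
  apply Finset.sum_bij φ
  · intro ij hij
    simp_rw [S, φ, Finset.compl_filter, Finset.mem_filter_univ, Fin.val_succ,
      Fin.val_castLT] at hij ⊢
    lia
  · rintro ⟨i, j⟩ hij ⟨i', j'⟩ hij' h
    rw [Prod.mk_inj]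
    exact ⟨Fin.ext (congrArg (fun x : P => (x.2 : ℕ)) h),
      Fin.succ_injective _ (congrArg (fun x : P => x.1) h)⟩
  · rintro ⟨i', j'⟩ hij'
    simp_rw [S, Finset.compl_filter, Finset.mem_filter_univ, not_le] at hij'
    refine ⟨(Fin.castSucc j', i'.pred <| ?_), ?_, ?_⟩
    · rintro rfl
      simp only [Fin.val_zero, not_lt_zero] at hij'
    · simpa [S] using Nat.le_sub_one_of_lt hij'
    · simp only [φ, Fin.castLT_castSucc, Fin.succ_pred]
  · rintro ⟨i, j⟩ hij
    simp only [S, Finset.mem_filter_univ] at hij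
    have h := δ_comp_δ (i := i.castLT (by omega)) (j := j) (by simpa [Fin.le_def] using hij)
    rw [Fin.castSucc_castLT] at h
    simp only [φ, Fin.val_succ, Fin.val_castLT]
    rw [← Category.assoc, ← Category.assoc, h, ← neg_smul]
    congr 1
    ring

end AlternatingSums

/-! ### Normalized cocycles of the standard simplices -/

variable {π : Type u} [AddCommGroup π] {k : ℕ}

/-- The group of `r`-simplices of `K(π, k + 1)`. -/
abbrev EMSimplex (π : Type u) [AddCommGroup π] (k r : ℕ) : Type u :=
  normalizedCocycles π (k + 1) (Δ[r] : SSet.{u})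

namespace EMSimplex

/-- The value of a cocycle on a simplex of the standard simplex. -/
def val {r : ℕ} (x : EMSimplex π k r) (τ : ⦋k + 1⦌ ⟶ ⦋r⦌) : π :=
  x.1 (SSet.stdSimplex.objEquiv.symm τ)

@[ext]
theorem ext {r : ℕ} {x y : EMSimplex π k r} (h : ∀ τ, x.val τ = y.val τ) : x = y :=
  Subtype.ext (funext fun σ => h (SSet.stdSimplex.objEquiv σ))

@[simp]
theorem val_add {r : ℕ} (x y : EMSimplex π k r) (τ : ⦋k + 1⦌ ⟶ ⦋r⦌) :
    (x + y).val τ = x.val τ + y.val τ := rfl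

@[simp]
theorem val_zero {r : ℕ} (τ : ⦋k + 1⦌ ⟶ ⦋r⦌) : (0 : EMSimplex π k r).val τ = 0 := rfl

theorem val_of_not_injective {r : ℕ} (x : EMSimplex π k r) (τ : ⦋k + 1⦌ ⟶ ⦋r⦌)
    (hτ : ¬ Function.Injective τ.toOrderHom) : x.val τ = 0 := by
  obtain ⟨i, τ, rfl⟩ := SimplexCategory.eq_σ_comp_of_not_injective τ hτ
  exact x.2.1 _ (SSet.σ_mem_degenerate (Δ[r] : SSet.{u}) i (SSet.stdSimplex.objEquiv.symm τ))

theorem alternatingSum_val {r : ℕ} (x : EMSimplex π k r) (β : ⦋k + 2⦌ ⟶ ⦋r⦌) :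
    ∑ i : Fin (k + 3), (-1 : ℤ) ^ (i : ℕ) • x.val (δ i ≫ β) = 0 :=
  congrFun x.2.2 (SSet.stdSimplex.objEquiv.symm β)

/-- The normalized cocycle with given values. -/
def mk {r : ℕ} (f : (⦋k + 1⦌ ⟶ ⦋r⦌) → π)
    (h0 : ∀ τ : ⦋k + 1⦌ ⟶ ⦋r⦌, ¬ Function.Injective τ.toOrderHom → f τ = 0)
    (hf : ∀ β : ⦋k + 2⦌ ⟶ ⦋r⦌, ∑ i : Fin (k + 3), (-1 : ℤ) ^ (i : ℕ) • f (δ i ≫ β) = 0) :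
    EMSimplex π k r :=
  ⟨fun σ => f (SSet.stdSimplex.objEquiv σ), by
    refine ⟨?_, funext fun β => hf (SSet.stdSimplex.objEquiv β)⟩
    rintro _ ⟨m, hm, g, y, rfl⟩
    refine h0 _ (not_injective_comp g (SSet.stdSimplex.objEquiv y) fun h => ?_)
    have := Fintype.card_le_of_injective _ h
    simp only [SimplexCategory.len_mk, Fintype.card_fin] at this
    omega⟩

/-- The pull-back of cocycles along a simplicial operator. -/
def res {m r : ℕ} (θ : ⦋r⦌ ⟶ ⦋m⦌) (x : EMSimplex π k m) : EMSimplex π k r :=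
  (eilenbergMacLane π (k + 1)).map θ.op x

@[simp]
theorem val_res {m r : ℕ} (θ : ⦋r⦌ ⟶ ⦋m⦌) (x : EMSimplex π k m) (τ : ⦋k + 1⦌ ⟶ ⦋r⦌) :
    (res θ x).val τ = x.val (τ ≫ θ) := rfl

/-- The change of coefficients. -/
def mapCoeff {r : ℕ} (h : π ≃+ π) (x : EMSimplex π k r) : EMSimplex π k r :=
  mk (fun τ => h (x.val τ)) (fun τ hτ => by rw [x.val_of_not_injective τ hτ, map_zero])
    (fun β => by rw [← map_zero h, ← x.alternatingSum_val β]; simp)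

@[simp]
theorem val_mapCoeff {r : ℕ} (h : π ≃+ π) (x : EMSimplex π k r) (τ : ⦋k + 1⦌ ⟶ ⦋r⦌) :
    (mapCoeff h x).val τ = h (x.val τ) := rfl

open scoped Classical in
/-- The cocycle of `Δ[k + 1]` with the given value on the non-degenerate `k + 1`-simplex. -/
noncomputable def single (k : ℕ) (a : π) : EMSimplex π k (k + 1) :=
  have h0 : ∀ τ : ⦋k + 1⦌ ⟶ ⦋k + 1⦌, ¬ Function.Injective τ.toOrderHom →
      (if τ = 𝟙 _ then a else 0) = 0 := fun τ hτ => by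
    rw [if_neg]
    rintro rfl
    exact hτ Function.injective_id
  mk (fun τ => if τ = 𝟙 _ then a else 0) h0 fun β =>
    alternatingSum_δ_of_not_injective h0 β fun h => by
      have := Fintype.card_le_of_injective _ h
      simp at this

@[simp]
theorem val_single_id (a : π) : (single k a).val (𝟙 _) = a := if_pos rfl

theorem eq_single (x : EMSimplex π k (k + 1)) : x = single k (x.val (𝟙 _)) := by
  ext τ
  by_cases hτ : Function.Injective τ.toOrderHom
  · have : Mono τ := SimplexCategory.mono_iff_injective.2 hτ
    rw [SimplexCategory.eq_id_of_mono τ, val_single_id]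
  · rw [val_of_not_injective _ _ hτ, val_of_not_injective _ _ hτ]

/-- These degenerate simplices, with two adjacent equal faces and all others zero, are the test
elements of `exists_affine`. -/
theorem val_res_σ_single {i : Fin (k + 2)} (a : π) (j : Fin (k + 3)) :
    (res (σ i) (single k a)).val (δ j) = if j = i.castSucc ∨ j = i.succ then a else 0 := by
  rw [val_res]
  split_ifs with h
  · rcases h with rfl | rfl
    · rw [δ_comp_σ_self, val_single_id]
    · rw [δ_comp_σ_succ, val_single_id]
  · rw [not_or] at h
    exact val_of_not_injective _ _ (not_injective_δ_comp_σ h.1 h.2)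

/-- The coboundary of a normalized cochain. -/
def ofCochain {r : ℕ} (a : (⦋k⦌ ⟶ ⦋r⦌) → π)
    (ha : ∀ τ : ⦋k⦌ ⟶ ⦋r⦌, ¬ Function.Injective τ.toOrderHom → a τ = 0) : EMSimplex π k r :=
  mk (fun τ => ∑ i : Fin (k + 2), (-1 : ℤ) ^ (i : ℕ) • a (δ i ≫ τ))
    (alternatingSum_δ_of_not_injective ha) (alternatingSum_alternatingSum a)

theorem val_ofCochain {r : ℕ} (a : (⦋k⦌ ⟶ ⦋r⦌) → π) (ha) (τ : ⦋k + 1⦌ ⟶ ⦋r⦌) :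
    (ofCochain a ha).val τ = ∑ i : Fin (k + 2), (-1 : ℤ) ^ (i : ℕ) • a (δ i ≫ τ) := rfl

end EMSimplex

/-- The join of the initial vertex with a simplex of the standard simplex. -/
def consZero {k r : ℕ} (τ : ⦋k⦌ ⟶ ⦋r⦌) : ⦋k + 1⦌ ⟶ ⦋r⦌ :=
  SimplexCategory.mkHom ⟨Fin.cons 0 τ.toOrderHom, by
    refine Fin.monotone_iff_le_succ.2 fun i => ?_
    refine Fin.cases ?_ (fun i => ?_) i
    · exact Fin.zero_le _
    · exact τ.toOrderHom.monotone (Fin.castSucc_lt_succ).le⟩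

theorem δ_zero_consZero {k r : ℕ} (τ : ⦋k⦌ ⟶ ⦋r⦌) : δ 0 ≫ consZero τ = τ := by
  ext a : 3
  rfl

theorem δ_succ_consZero {k r : ℕ} (i : Fin (k + 2)) (τ : ⦋k + 1⦌ ⟶ ⦋r⦌) :
    δ i.succ ≫ consZero τ = consZero (δ i ≫ τ) := by
  ext a : 3
  refine Fin.cases ?_ (fun a => ?_) a
  · change (Fin.cons 0 τ.toOrderHom : Fin (k + 3) → Fin (r + 1)) (i.succ.succAbove 0) =
      (Fin.cons 0 (δ i ≫ τ).toOrderHom : Fin (k + 2) → Fin (r + 1)) 0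
    rw [Fin.succ_succAbove_zero]
    rfl
  · change (Fin.cons 0 τ.toOrderHom : Fin (k + 3) → Fin (r + 1)) (i.succ.succAbove a.succ) =
      (Fin.cons 0 (δ i ≫ τ).toOrderHom : Fin (k + 2) → Fin (r + 1)) a.succ
    rw [Fin.succ_succAbove_succ]
    rfl

/-- The standard simplex is a cone with apex its initial vertex: evaluating `z` on cones gives a
primitive, by the cocycle condition on `consZero τ`. -/
theorem EMSimplex.exists_eq_ofCochain {r : ℕ} (z : EMSimplex π k r) :
    ∃ (a : (⦋k⦌ ⟶ ⦋r⦌) → π)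
      (ha : ∀ τ : ⦋k⦌ ⟶ ⦋r⦌, ¬ Function.Injective τ.toOrderHom → a τ = 0),
      ofCochain a ha = z := by
  refine ⟨fun τ => z.val (consZero τ), fun τ hτ => z.val_of_not_injective _ fun h => hτ ?_, ?_⟩
  · rw [← δ_zero_consZero τ, SimplexCategory.comp_toOrderHom]
    exact h.comp (g := (consZero τ).toOrderHom) (f := (δ 0).toOrderHom)
      (Fin.succAbove_right_injective (p := 0))
  · ext τ
    have h := z.alternatingSum_val (consZero τ)
    rw [Fin.sum_univ_succ, δ_zero_consZero] at h
    simp only [δ_succ_consZero, Fin.val_zero, pow_zero, one_smul, Fin.val_succ, pow_succ, mul_neg,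
      mul_one, neg_smul, Finset.sum_neg_distrib] at h
    rw [val_ofCochain, ← sub_eq_zero, ← neg_sub, sub_eq_add_neg, h, neg_zero]

end

section

open Simplicial Opposite SimplexCategory

variable {π : Type u} [AddCommGroup π] {k : ℕ}

/-! ### Automorphisms of `Δ[q] × K(π, n)` over `Δ[q]` are affine -/

theorem EMSimplex.res_add {m r : ℕ} (θ : ⦋r⦌ ⟶ ⦋m⦌) (x y : EMSimplex π k m) :
    res θ (x + y) = res θ x + res θ y := rfl

theorem EMSimplex.mapCoeff_add {r : ℕ} (h : π ≃+ π) (x y : EMSimplex π k r) :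
    mapCoeff h (x + y) = mapCoeff h x + mapCoeff h y := by
  ext τ
  simp

theorem EMSimplex.mapCoeff_trans {r : ℕ} (h h' : π ≃+ π) (x : EMSimplex π k r) :
    mapCoeff (h.trans h') x = mapCoeff h' (mapCoeff h x) := rfl

/-- Replacing the first `t` vertices of a simplex by the initial vertex. -/
def collapse {q : ℕ} (α : ⦋k⦌ ⟶ ⦋q⦌) (t : ℕ) : ⦋k⦌ ⟶ ⦋q⦌ :=
  SimplexCategory.mkHom ⟨fun i => if (i : ℕ) < t then 0 else α.toOrderHom i, fun i j hij => by
    have : (i : ℕ) ≤ j := hij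
    dsimp only
    split_ifs
    · exact le_rfl
    · exact Fin.zero_le _
    · omega
    · exact α.toOrderHom.monotone hij⟩

theorem exists_δ_comp_eq_collapse {q : ℕ} (α : ⦋k⦌ ⟶ ⦋q⦌) (t : Fin (k + 1)) :
    ∃ β : ⦋k + 1⦌ ⟶ ⦋q⦌, δ t.castSucc ≫ β = collapse α t ∧ δ t.succ ≫ β = collapse α (t + 1) := by
  -- The simplex has `t + 1` initial vertices followed by the vertices `t, …, k` of `α`; its two
  -- faces omit the last initial vertex and vertex `t` of `α`.
  refine ⟨SimplexCategory.mkHom ⟨fun i => if (i : ℕ) ≤ t then 0 else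
    α.toOrderHom (⟨i - 1, by omega⟩ : Fin (k + 1)), fun i j hij => ?_⟩, ?_, ?_⟩
  · have : (i : ℕ) ≤ j := hij
    dsimp only
    split_ifs
    · exact le_rfl
    · exact Fin.zero_le _
    · omega
    · exact α.toOrderHom.monotone (by rw [Fin.le_def]; exact Nat.sub_le_sub_right this 1)
  · ext a : 3
    change (if (t.castSucc.succAbove a : ℕ) ≤ t then 0 else
      α.toOrderHom (⟨(t.castSucc.succAbove a : ℕ) - 1, _⟩ : Fin (k + 1))) =
        if (a : ℕ) < t then 0 else α.toOrderHom a
    have h := coe_succAbove t.castSucc a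
    rw [Fin.val_castSucc] at h
    split_ifs with h1 h2 h2
    · rfl
    · rw [if_neg h2] at h; omega
    · rw [if_pos h2] at h; omega
    · rw [if_neg h2] at h
      exact congrArg α.toOrderHom (Fin.ext (by dsimp only; omega))
  · ext a : 3
    change (if (t.succ.succAbove a : ℕ) ≤ t then 0 else
      α.toOrderHom (⟨(t.succ.succAbove a : ℕ) - 1, _⟩ : Fin (k + 1))) =
        if (a : ℕ) < t + 1 then 0 else α.toOrderHom a
    have h := coe_succAbove t.succ a
    rw [Fin.val_succ] at h
    split_ifs with h1 h2 h2
    · rfl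
    · rw [if_neg h2] at h; omega
    · rw [if_pos h2] at h; omega
    · rw [if_neg h2] at h
      exact congrArg α.toOrderHom (Fin.ext (by dsimp only; omega))

theorem eq_of_δ_eq {X : Type*} {q : ℕ} (v : (⦋k⦌ ⟶ ⦋q⦌) → X)
    (hv : ∀ (β : ⦋k + 1⦌ ⟶ ⦋q⦌) (i : Fin (k + 1)), v (δ i.castSucc ≫ β) = v (δ i.succ ≫ β))
    (α α' : ⦋k⦌ ⟶ ⦋q⦌) : v α = v α' := by
  have key : ∀ α : ⦋k⦌ ⟶ ⦋q⦌, v α = v (SimplexCategory.mkHom ⟨fun _ => 0, monotone_const⟩) := by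
    intro α
    have h : ∀ t, t ≤ k + 1 → v α = v (collapse α t) := by
      intro t
      induction t with
      | zero =>
        intro _
        congr 1
        ext a : 3
        rfl
      | succ t ih =>
        intro ht
        obtain ⟨β, h1, h2⟩ := exists_δ_comp_eq_collapse α ⟨t, ht⟩
        rw [ih (by omega), ← h1, hv, h2]
    rw [h (k + 1) le_rfl]
    congr 1
    ext a : 3
    exact if_pos a.2
  rw [key α, key α']

-- By naturality `φ` is determined by functions `w α : π → π` on `(k + 1)`-simplices. That `φ`
-- preserves cocycles forces `w α - w α 0` to be independent of `α` and additive; bijectivity of `φ`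
-- makes it an automorphism.
open EMSimplex in
theorem exists_affine {q : ℕ} (φ : ∀ {r : ℕ}, (⦋r⦌ ⟶ ⦋q⦌) → EMSimplex π k r → EMSimplex π k r)
    (hφ : ∀ {m r : ℕ} (θ : ⦋r⦌ ⟶ ⦋m⦌) (ρ : ⦋m⦌ ⟶ ⦋q⦌) (x : EMSimplex π k m),
      res θ (φ ρ x) = φ (θ ≫ ρ) (res θ x))
    (hbij : ∀ {r : ℕ} (ρ : ⦋r⦌ ⟶ ⦋q⦌), Function.Bijective (φ ρ)) :
    ∃ h : π ≃+ π, ∀ {r : ℕ} (ρ : ⦋r⦌ ⟶ ⦋q⦌) (x : EMSimplex π k r),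
      φ ρ x = mapCoeff h x + φ ρ 0 := by
  let w : (⦋k + 1⦌ ⟶ ⦋q⦌) → π → π := fun α a => (φ α (single k a)).val (𝟙 _)
  have hw : ∀ {r : ℕ} (ρ : ⦋r⦌ ⟶ ⦋q⦌) (x : EMSimplex π k r) (τ : ⦋k + 1⦌ ⟶ ⦋r⦌),
      (φ ρ x).val τ = w (τ ≫ ρ) (x.val τ) := by
    intro r ρ x τ
    have h1 := val_res τ (φ ρ x) (𝟙 _)
    rw [Category.id_comp] at h1
    rw [← h1, hφ, eq_single (res τ x), val_res, Category.id_comp]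
  let v : (⦋k + 1⦌ ⟶ ⦋q⦌) → π → π := fun α a => w α a - w α 0
  have hv0 : ∀ α, v α 0 = 0 := fun α => sub_self _
  have hsum : ∀ (β : ⦋k + 2⦌ ⟶ ⦋q⦌) (x : EMSimplex π k (k + 2)),
      ∑ i : Fin (k + 3), (-1 : ℤ) ^ (i : ℕ) • v (δ i ≫ β) (x.val (δ i)) = 0 := by
    intro β x
    have h1 := (φ β x).alternatingSum_val (𝟙 _)
    have h2 := (φ β 0).alternatingSum_val (𝟙 _)
    simp only [Category.comp_id, hw, val_zero] at h1 h2
    simp only [v, smul_sub, Finset.sum_sub_distrib, h1, h2, sub_zero]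
  have hface : ∀ (β : ⦋k + 2⦌ ⟶ ⦋q⦌) (i : Fin (k + 2)),
      v (δ i.castSucc ≫ β) = v (δ i.succ ≫ β) := by
    intro β i
    funext a
    have h := hsum β (res (σ i) (single k a))
    have hne : i.castSucc ≠ i.succ := by simp [Fin.ext_iff]
    rw [Fintype.sum_eq_add i.castSucc i.succ hne fun j hj => by
      rw [val_res_σ_single, if_neg (by tauto), hv0, smul_zero], val_res_σ_single,
      val_res_σ_single, if_pos (Or.inl rfl), if_pos (Or.inr rfl), Fin.val_castSucc, Fin.val_succ,
      pow_succ, mul_neg_one, neg_smul, ← sub_eq_add_neg, ← smul_sub] at h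
    have h2 := congrArg (fun y => (-1 : ℤ) ^ (i : ℕ) • y) h
    simp only [smul_smul, ← pow_add, ← two_mul, pow_mul, smul_zero] at h2
    simpa [sub_eq_zero] using h2
  have hconst : ∀ α α' : ⦋k + 1⦌ ⟶ ⦋q⦌, v α = v α' := eq_of_δ_eq v hface
  let α₀ : ⦋k + 1⦌ ⟶ ⦋q⦌ := SimplexCategory.mkHom ⟨fun _ => 0, monotone_const⟩
  let β₀ : ⦋k + 2⦌ ⟶ ⦋q⦌ := SimplexCategory.mkHom ⟨fun _ => 0, monotone_const⟩
  have hadd : ∀ a b, v α₀ (a + b) = v α₀ a + v α₀ b := by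
    intro a b
    -- The first three faces of this simplex are `a`, `a + b`, `b`, and the others vanish.
    have h := hsum β₀ (res (σ 0) (single k a) + res (σ 1) (single k b))
    simp only [fun i => hconst (δ i ≫ β₀) α₀, val_add, val_res_σ_single] at h
    rw [Fin.sum_univ_succ, Fin.sum_univ_succ, Fin.sum_univ_succ] at h
    simp only [Fin.ext_iff, Fin.val_succ, Fin.val_zero, Fin.val_castSucc, Fin.val_one] at h
    simp [hv0] at h
    exact neg_add_eq_zero.1 ((add_left_comm _ _ _).symm.trans h)
  have hbij' : Function.Bijective (v α₀) := by
    constructor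
    · intro a b hab
      have h1 : w α₀ a = w α₀ b := sub_left_injective hab
      have h2 : φ α₀ (single k a) = φ α₀ (single k b) := by
        rw [eq_single (φ α₀ (single k a)), eq_single (φ α₀ (single k b))]
        exact congrArg _ h1
      have h3 := congrArg (fun x => x.val (𝟙 _)) ((hbij α₀).1 h2)
      simpa using h3
    · intro b
      obtain ⟨x, hx⟩ := (hbij α₀).2 (single k (b + w α₀ 0))
      refine ⟨x.val (𝟙 _), ?_⟩
      have h1 := hw α₀ x (𝟙 _)
      rw [hx, val_single_id, Category.id_comp] at h1
      exact sub_eq_iff_eq_add.2 h1.symm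
  refine ⟨AddEquiv.ofBijective (AddMonoidHom.mk' (v α₀) hadd) hbij', fun {r} ρ x => ?_⟩
  ext τ
  change _ = v α₀ (x.val τ) + (φ ρ 0).val τ
  rw [hw, hw, val_zero, ← hconst (τ ≫ ρ) α₀]
  exact (sub_add_cancel _ _).symm

/-! ### Coordinates on the fibers of a bundle -/

variable {E B : SSet.{u}}

/-- Coordinates on the part of `E` lying over the simplex `σ` of `B`. -/
structure FiberCoordinates (p : E ⟶ B) (π : Type u) [AddCommGroup π] (k : ℕ) {q : ℕ}
    (σ : B _⦋q⦌) where
  point {r : ℕ} (ρ : ⦋r⦌ ⟶ ⦋q⦌) (x : EMSimplex π k r) : E _⦋r⦌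
  proj_point {r : ℕ} (ρ : ⦋r⦌ ⟶ ⦋q⦌) (x : EMSimplex π k r) :
    p.app _ (point ρ x) = B.map ρ.op σ
  point_injective {r : ℕ} (ρ : ⦋r⦌ ⟶ ⦋q⦌) : Function.Injective (point ρ)
  exists_point_eq {r : ℕ} (ρ : ⦋r⦌ ⟶ ⦋q⦌) (e : E _⦋r⦌) (he : p.app _ e = B.map ρ.op σ) :
    ∃ x, point ρ x = e
  map_point {m r : ℕ} (θ : ⦋r⦌ ⟶ ⦋m⦌) (ρ : ⦋m⦌ ⟶ ⦋q⦌) (x : EMSimplex π k m) :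
    E.map θ.op (point ρ x) = point (θ ≫ ρ) (x.res θ)

theorem nonempty_fiberCoordinates {p : E ⟶ B}
    (hp : IsLocallyTrivialBundle p (eilenbergMacLane π (k + 1))) {q : ℕ} (σ : B _⦋q⦌) :
    Nonempty (FiberCoordinates p π k σ) := by
  obtain ⟨t, ht⟩ := hp q σ
  let F : SSet.{u} := eilenbergMacLane π (k + 1)
  let T : SSet.{u} := pullbackTotal p (SSet.yonedaEquiv.symm σ)
  let y : ∀ {r : ℕ}, (⦋r⦌ ⟶ ⦋q⦌) → EMSimplex π k r → ((Δ[q] : SSet.{u}) ⊗ F) _⦋r⦌ :=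
    fun ρ x => (SSet.stdSimplex.objEquiv.symm ρ, x)
  have ht' : ∀ {r : ℕ} (z : ((Δ[q] : SSet.{u}) ⊗ F) _⦋r⦌),
      (t.hom.app (op ⦋r⦌) z).1.2 = z.1 := fun {r} z =>
    congrArg (fun f : _ ⟶ (Δ[q] : SSet.{u}) => f.app (op ⦋r⦌) z) ht
  have hy : ∀ {r : ℕ} (ρ : ⦋r⦌ ⟶ ⦋q⦌) (x : EMSimplex π k r),
      (t.hom.app (op ⦋r⦌) (y ρ x)).1.2 = SSet.stdSimplex.objEquiv.symm ρ := fun ρ x => ht' (y ρ x)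
  refine ⟨{
    point := fun {r} ρ x => (t.hom.app (op ⦋r⦌) (y ρ x)).1.1
    proj_point := ?_
    point_injective := ?_
    exists_point_eq := ?_
    map_point := ?_ }⟩
  · intro r ρ x
    exact (t.hom.app (op ⦋r⦌) (y ρ x)).2.trans
      (congrArg ((SSet.yonedaEquiv.symm σ).app (op ⦋r⦌)) (hy ρ x))
  · intro r ρ x x' hxy
    have h : t.hom.app (op ⦋r⦌) (y ρ x) = t.hom.app (op ⦋r⦌) (y ρ x') :=
      Subtype.ext (Prod.ext hxy ((hy ρ x).trans (hy ρ x').symm))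
    have hid : ∀ z, t.inv.app (op ⦋r⦌) (t.hom.app (op ⦋r⦌) z) = z := fun z =>
      congrArg (fun f : (Δ[q] : SSet.{u}) ⊗ F ⟶ (Δ[q] : SSet.{u}) ⊗ F => f.app (op ⦋r⦌) z)
        t.hom_inv_id
    exact congrArg Prod.snd
      ((hid (y ρ x)).symm.trans ((congrArg (t.inv.app (op ⦋r⦌)) h).trans (hid (y ρ x'))))
  · intro r ρ e he
    let z : T _⦋r⦌ := ⟨(e, SSet.stdSimplex.objEquiv.symm ρ), he⟩
    have hid : t.hom.app (op ⦋r⦌) (t.inv.app (op ⦋r⦌) z) = z :=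
      congrArg (fun f : T ⟶ T => f.app (op ⦋r⦌) z) t.inv_hom_id
    have h1 : (t.inv.app (op ⦋r⦌) z).1 = SSet.stdSimplex.objEquiv.symm ρ :=
      (ht' (t.inv.app (op ⦋r⦌) z)).symm.trans (congrArg (fun w => w.1.2) hid)
    have h2 : y ρ (t.inv.app (op ⦋r⦌) z).2 = t.inv.app (op ⦋r⦌) z := Prod.ext h1.symm rfl
    exact ⟨(t.inv.app (op ⦋r⦌) z).2,
      congrArg (fun w => w.1.1) ((congrArg (t.hom.app (op ⦋r⦌)) h2).trans hid)⟩
  · intro m r θ ρ x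
    exact (congrArg (fun w => w.1.1) (NatTrans.naturality_apply t.hom θ.op (y ρ x))).symm

end

section

open Simplicial Opposite SimplexCategory

variable {π : Type u} [AddCommGroup π] {k : ℕ} {E B : SSet.{u}} {p : E ⟶ B}

/-! ### Transport of coefficients -/

/-- Both coordinate systems parametrize the same simplices of `E`, so the change of coordinates is
natural and bijective, and `exists_affine` applies. -/
theorem exists_transition (κ : ∀ (q : ℕ) (σ : B _⦋q⦌), FiberCoordinates p π k σ) {m r : ℕ}
    (θ : ⦋r⦌ ⟶ ⦋m⦌) (σ : B _⦋m⦌) (σ' : B _⦋r⦌) (hσ : σ' = B.map θ.op σ) :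
    ∃ φ : ∀ {s : ℕ}, (⦋s⦌ ⟶ ⦋r⦌) → EMSimplex π k s → EMSimplex π k s,
      (∀ {s : ℕ} (ρ : ⦋s⦌ ⟶ ⦋r⦌) (x : EMSimplex π k s),
        (κ _ σ').point ρ (φ ρ x) = (κ _ σ).point (ρ ≫ θ) x) ∧
      ∃ h : π ≃+ π, ∀ {s : ℕ} (ρ : ⦋s⦌ ⟶ ⦋r⦌) (x : EMSimplex π k s),
        φ ρ x = x.mapCoeff h + φ ρ 0 := by
  have hmap : ∀ {s : ℕ} (ρ : ⦋s⦌ ⟶ ⦋r⦌), B.map ρ.op σ' = B.map (ρ ≫ θ).op σ := fun ρ => by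
    rw [hσ, op_comp, Functor.map_comp_apply]
  have hex : ∀ {s : ℕ} (ρ : ⦋s⦌ ⟶ ⦋r⦌) (x : EMSimplex π k s),
      ∃ y, (κ _ σ').point ρ y = (κ _ σ).point (ρ ≫ θ) x := fun ρ x =>
    (κ _ σ').exists_point_eq ρ _ (((κ _ σ).proj_point _ x).trans (hmap ρ).symm)
  choose φ hφ using @hex
  refine ⟨φ, hφ, exists_affine φ (fun θ' ρ x => ?_) (fun ρ => ⟨fun x y hxy => ?_, fun y => ?_⟩)⟩
  · apply (κ _ σ').point_injective
    rw [← FiberCoordinates.map_point, hφ, hφ, FiberCoordinates.map_point, Category.assoc]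
  · apply (κ _ σ).point_injective (ρ ≫ θ)
    rw [← hφ, ← hφ, hxy]
  · obtain ⟨x, hx⟩ := (κ _ σ).exists_point_eq (ρ ≫ θ) ((κ _ σ').point ρ y)
      (((κ _ σ').proj_point _ y).trans (hmap ρ))
    refine ⟨x, (κ _ σ').point_injective ρ ?_⟩
    rw [hφ, hx]

/-- The change of coordinates from `σ` to its face `σ'` along `θ` acts on the coefficients
by `h`. -/
def IsTransport (κ : ∀ (q : ℕ) (σ : B _⦋q⦌), FiberCoordinates p π k σ) {m r : ℕ}
    (θ : ⦋r⦌ ⟶ ⦋m⦌) (σ : B _⦋m⦌) (σ' : B _⦋r⦌) (h : π ≃+ π) : Prop :=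
  ∀ (s : ℕ) (ρ : ⦋s⦌ ⟶ ⦋r⦌), ∃ z : EMSimplex π k s, ∀ x : EMSimplex π k s,
    (κ _ σ).point (ρ ≫ θ) x = (κ _ σ').point ρ (x.mapCoeff h + z)

variable {κ : ∀ (q : ℕ) (σ : B _⦋q⦌), FiberCoordinates p π k σ}

theorem exists_isTransport (κ : ∀ (q : ℕ) (σ : B _⦋q⦌), FiberCoordinates p π k σ) {m r : ℕ}
    (θ : ⦋r⦌ ⟶ ⦋m⦌) (σ : B _⦋m⦌) : ∃ h, IsTransport κ θ σ (B.map θ.op σ) h := by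
  obtain ⟨φ, hφ, h, hh⟩ := exists_transition κ θ σ _ rfl
  exact ⟨h, fun _ ρ => ⟨φ ρ 0, fun x => by rw [← hh, hφ]⟩⟩

theorem IsTransport.unique {m r : ℕ} {θ : ⦋r⦌ ⟶ ⦋m⦌} {σ : B _⦋m⦌} {σ' : B _⦋r⦌} {h h' : π ≃+ π}
    (H : IsTransport κ θ σ σ' h) (H' : IsTransport κ θ σ σ' h') : h = h' := by
  obtain ⟨z, hz⟩ := H (k + 1) (SimplexCategory.mkHom ⟨fun _ => 0, monotone_const⟩)
  obtain ⟨z', hz'⟩ := H' (k + 1) (SimplexCategory.mkHom ⟨fun _ => 0, monotone_const⟩)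
  have key : ∀ x : EMSimplex π k (k + 1), x.mapCoeff h + z = x.mapCoeff h' + z' := fun x =>
    (κ _ σ').point_injective _ ((hz x).symm.trans (hz' x))
  have hzz : z = z' := by
    have h0 := key 0
    have h1 : ∀ g : π ≃+ π, (0 : EMSimplex π k (k + 1)).mapCoeff g = 0 := fun g => by
      ext τ; simp
    rwa [h1, h1, zero_add, zero_add] at h0
  ext a
  have h1 := key (EMSimplex.single k a)
  rw [hzz, add_left_inj] at h1
  simpa using congrArg (fun x => x.val (𝟙 _)) h1

theorem IsTransport.comp {m r s : ℕ} {θ : ⦋r⦌ ⟶ ⦋m⦌} {τ : ⦋s⦌ ⟶ ⦋r⦌} {σ : B _⦋m⦌} {σ' : B _⦋r⦌}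
    {σ'' : B _⦋s⦌} {h h' : π ≃+ π} (H : IsTransport κ θ σ σ' h) (H' : IsTransport κ τ σ' σ'' h') :
    IsTransport κ (τ ≫ θ) σ σ'' (h.trans h') := by
  intro t ρ
  obtain ⟨z, hz⟩ := H _ (ρ ≫ τ)
  obtain ⟨z', hz'⟩ := H' _ ρ
  refine ⟨z.mapCoeff h' + z', fun x => ?_⟩
  rw [← Category.assoc, hz, hz', EMSimplex.mapCoeff_add, EMSimplex.mapCoeff_trans, add_assoc]

/-- The action on the coefficients of the change of coordinates from `σ` to a face of `σ`. -/
noncomputable def transport (κ : ∀ (q : ℕ) (σ : B _⦋q⦌), FiberCoordinates p π k σ) {m r : ℕ}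
    (θ : ⦋r⦌ ⟶ ⦋m⦌) (σ : B _⦋m⦌) : π ≃+ π :=
  (exists_isTransport κ θ σ).choose

theorem isTransport_transport (κ : ∀ (q : ℕ) (σ : B _⦋q⦌), FiberCoordinates p π k σ) {m r : ℕ}
    (θ : ⦋r⦌ ⟶ ⦋m⦌) (σ : B _⦋m⦌) : IsTransport κ θ σ (B.map θ.op σ) (transport κ θ σ) :=
  (exists_isTransport κ θ σ).choose_spec

/-- Uniqueness of the linear part makes the chosen automorphisms a local coefficient system on `B`.
-/
theorem transport_comp {m r s : ℕ} (τ : ⦋s⦌ ⟶ ⦋r⦌) (θ : ⦋r⦌ ⟶ ⦋m⦌) (σ : B _⦋m⦌) :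
    transport κ (τ ≫ θ) σ = (transport κ θ σ).trans (transport κ τ (B.map θ.op σ)) := by
  have h := (isTransport_transport κ θ σ).comp (isTransport_transport κ τ (B.map θ.op σ))
  rw [← Functor.map_comp_apply, ← op_comp] at h
  exact (isTransport_transport κ (τ ≫ θ) σ).unique h

/-! ### Translations along the fibers -/

theorem exists_coord (κ : ∀ (q : ℕ) (σ : B _⦋q⦌), FiberCoordinates p π k σ) {m : ℕ}
    (e : E _⦋m⦌) : ∃ x, (κ _ (p.app _ e)).point (𝟙 _) x = e :=
  (κ _ (p.app _ e)).exists_point_eq _ e (by rw [op_id, Functor.map_id_apply])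

/-- The translation of a simplex of `E` by a simplex of `K(π, k + 1)`. -/
noncomputable def fiberTranslate (κ : ∀ (q : ℕ) (σ : B _⦋q⦌), FiberCoordinates p π k σ) {m : ℕ}
    (e : E _⦋m⦌) (z : EMSimplex π k m) : E _⦋m⦌ :=
  (κ _ (p.app _ e)).point (𝟙 _) ((exists_coord κ e).choose + z)

theorem proj_point_id {m : ℕ} (σ : B _⦋m⦌) (x : EMSimplex π k m) :
    p.app _ ((κ _ σ).point (𝟙 _) x) = σ := by
  rw [FiberCoordinates.proj_point, op_id, Functor.map_id_apply]

theorem fiberTranslate_point {m : ℕ} (σ : B _⦋m⦌) (x z : EMSimplex π k m) :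
    fiberTranslate κ ((κ _ σ).point (𝟙 _) x) z = (κ _ σ).point (𝟙 _) (x + z) := by
  have key : ∀ (e : E _⦋m⦌) (σ : B _⦋m⦌) (x : EMSimplex π k m), p.app _ e = σ →
      (κ _ σ).point (𝟙 _) x = e → fiberTranslate κ e z = (κ _ σ).point (𝟙 _) (x + z) := by
    rintro e _ x rfl hx
    unfold fiberTranslate
    rw [(κ _ (p.app _ e)).point_injective _ ((exists_coord κ e).choose_spec.trans hx.symm)]
  exact key _ σ x (proj_point_id σ x) rfl

theorem exists_eq_point (κ : ∀ (q : ℕ) (σ : B _⦋q⦌), FiberCoordinates p π k σ) {m : ℕ}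
    (e : E _⦋m⦌) (σ : B _⦋m⦌) (h : p.app _ e = σ) : ∃ x, e = (κ _ σ).point (𝟙 _) x := by
  subst h
  obtain ⟨x, hx⟩ := exists_coord κ e
  exact ⟨x, hx.symm⟩

theorem proj_fiberTranslate {m : ℕ} (e : E _⦋m⦌) (z : EMSimplex π k m) :
    p.app _ (fiberTranslate κ e z) = p.app _ e :=
  proj_point_id _ _

theorem fiberTranslate_translate {m : ℕ} (e : E _⦋m⦌) (z z' : EMSimplex π k m) :
    fiberTranslate κ (fiberTranslate κ e z) z' = fiberTranslate κ e (z + z') := by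
  obtain ⟨x, hx⟩ := exists_eq_point κ e _ rfl
  rw [hx, fiberTranslate_point, fiberTranslate_point, fiberTranslate_point, add_assoc]

theorem fiberTranslate_zero {m : ℕ} (e : E _⦋m⦌) : fiberTranslate κ e (0 : EMSimplex π k m) = e := by
  obtain ⟨x, hx⟩ := exists_eq_point κ e _ rfl
  rw [hx, fiberTranslate_point, add_zero]

theorem exists_fiberTranslate_eq (κ : ∀ (q : ℕ) (σ : B _⦋q⦌), FiberCoordinates p π k σ) {m : ℕ}
    {e e' : E _⦋m⦌} (h : p.app _ e = p.app _ e') : ∃ z, fiberTranslate κ e z = e' := by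
  obtain ⟨x, hx⟩ := exists_eq_point κ e _ h
  obtain ⟨x', hx'⟩ := exists_eq_point κ e' _ rfl
  refine ⟨x' - x, ?_⟩
  rw [hx, fiberTranslate_point, add_sub_cancel]
  exact hx'.symm

/-- The constant term `z₀` of the affine change of coordinates occurs on both sides; only its linear
part acts on `z`. -/
theorem map_fiberTranslate {m r : ℕ} (θ : ⦋r⦌ ⟶ ⦋m⦌) (e : E _⦋m⦌) (z : EMSimplex π k m) :
    E.map θ.op (fiberTranslate κ e z) =
      fiberTranslate κ (E.map θ.op e) ((z.res θ).mapCoeff (transport κ θ (p.app _ e))) := by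
  obtain ⟨x, hx⟩ := exists_eq_point κ e _ rfl
  generalize p.app _ e = σ at hx ⊢
  subst hx
  obtain ⟨z₀, hz₀⟩ := isTransport_transport κ θ σ _ (𝟙 _)
  rw [Category.id_comp] at hz₀
  rw [fiberTranslate_point, FiberCoordinates.map_point, FiberCoordinates.map_point, Category.comp_id,
    hz₀, hz₀, fiberTranslate_point, EMSimplex.res_add, EMSimplex.mapCoeff_add, add_right_comm]

/-! ### The action of labelled cochains -/

open scoped Classical in
/-- The cochain of `Δ[m]` with values in the fiber over `σ` determined by a labelling of the
vertices and a function on labelled simplices of `B`. -/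
noncomputable def labelledCochain (κ : ∀ (q : ℕ) (σ : B _⦋q⦌), FiberCoordinates p π k σ) {m : ℕ}
    (g : B _⦋k⦌ × (Fin (k + 1) → ℕ) → π) (σ : B _⦋m⦌) (s : Fin (m + 1) → ℕ) (τ : ⦋k⦌ ⟶ ⦋m⦌) : π :=
  -- Requiring distinct labels makes the cochain normalized; requiring non-zero labels makes the
  -- zero labelling act trivially.
  if Function.Injective (s ∘ τ.toOrderHom) ∧ ∀ i, (s ∘ τ.toOrderHom) i ≠ 0 then
    (transport κ τ σ).symm (g (B.map τ.op σ, s ∘ τ.toOrderHom))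
  else 0

theorem labelledCochain_of_not_injective {m : ℕ} (g : B _⦋k⦌ × (Fin (k + 1) → ℕ) → π)
    (σ : B _⦋m⦌) (s : Fin (m + 1) → ℕ) (τ : ⦋k⦌ ⟶ ⦋m⦌)
    (hτ : ¬ Function.Injective τ.toOrderHom) : labelledCochain κ g σ s τ = 0 :=
  if_neg fun h => hτ (Function.Injective.of_comp h.1)

theorem labelledCochain_add {m : ℕ} (g h : B _⦋k⦌ × (Fin (k + 1) → ℕ) → π)
    (σ : B _⦋m⦌) (s : Fin (m + 1) → ℕ) (τ : ⦋k⦌ ⟶ ⦋m⦌) :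
    labelledCochain κ (g + h) σ s τ = labelledCochain κ g σ s τ + labelledCochain κ h σ s τ := by
  unfold labelledCochain
  split_ifs
  · rw [Pi.add_apply, map_add]
  · rw [add_zero]

theorem labelledCochain_map {m r : ℕ} (g : B _⦋k⦌ × (Fin (k + 1) → ℕ) → π) (θ : ⦋r⦌ ⟶ ⦋m⦌)
    (σ : B _⦋m⦌) (s : Fin (m + 1) → ℕ) (τ : ⦋k⦌ ⟶ ⦋r⦌) :
    transport κ θ σ (labelledCochain κ g σ s (τ ≫ θ)) =
      labelledCochain κ g (B.map θ.op σ) (s ∘ θ.toOrderHom) τ := by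
  have hs : s ∘ (τ ≫ θ).toOrderHom = (s ∘ θ.toOrderHom) ∘ τ.toOrderHom := rfl
  unfold labelledCochain
  rw [hs]
  split_ifs
  · rw [transport_comp, op_comp, Functor.map_comp_apply]
    simp
  · exact map_zero _

/-- The coboundary of `labelledCochain`. -/
noncomputable def labelledCocycle (κ : ∀ (q : ℕ) (σ : B _⦋q⦌), FiberCoordinates p π k σ) {m : ℕ}
    (g : B _⦋k⦌ × (Fin (k + 1) → ℕ) → π) (σ : B _⦋m⦌) (s : Fin (m + 1) → ℕ) : EMSimplex π k m :=
  EMSimplex.ofCochain (labelledCochain κ g σ s) (labelledCochain_of_not_injective g σ s)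

theorem labelledCocycle_add {m : ℕ} (g h : B _⦋k⦌ × (Fin (k + 1) → ℕ) → π)
    (σ : B _⦋m⦌) (s : Fin (m + 1) → ℕ) :
    labelledCocycle κ (g + h) σ s = labelledCocycle κ g σ s + labelledCocycle κ h σ s := by
  ext τ
  simp only [labelledCocycle, EMSimplex.val_add, EMSimplex.val_ofCochain, labelledCochain_add,
    smul_add, Finset.sum_add_distrib]

theorem labelledCocycle_zero {m : ℕ} (g : B _⦋k⦌ × (Fin (k + 1) → ℕ) → π) (σ : B _⦋m⦌) :
    labelledCocycle κ g σ (fun _ => 0) = 0 := by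
  ext τ
  rw [EMSimplex.val_zero, labelledCocycle, EMSimplex.val_ofCochain]
  refine Finset.sum_eq_zero fun i _ => ?_
  rw [labelledCochain, if_neg fun h => h.2 0 rfl, smul_zero]

theorem labelledCocycle_map {m r : ℕ} (g : B _⦋k⦌ × (Fin (k + 1) → ℕ) → π) (θ : ⦋r⦌ ⟶ ⦋m⦌)
    (σ : B _⦋m⦌) (s : Fin (m + 1) → ℕ) :
    ((labelledCocycle κ g σ s).res θ).mapCoeff (transport κ θ σ) =
      labelledCocycle κ g (B.map θ.op σ) (s ∘ θ.toOrderHom) := by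
  ext τ
  simp only [labelledCocycle, EMSimplex.val_mapCoeff, EMSimplex.val_res, EMSimplex.val_ofCochain,
    map_sum, map_zsmul, ← labelledCochain_map, Category.assoc]

-- As `s` is injective, `τ` can be recovered from `s ∘ τ`. So the values of `g` on the labelled
-- faces can be prescribed independently, even if faces of `σ` coincide in `B`.
open scoped Classical in
theorem exists_labelledCocycle_eq (κ : ∀ (q : ℕ) (σ : B _⦋q⦌), FiberCoordinates p π k σ) {m : ℕ}
    (σ : B _⦋m⦌) {s : Fin (m + 1) → ℕ} (hs : Function.Injective s) (hs0 : ∀ i, s i ≠ 0)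
    (z : EMSimplex π k m) : ∃ g, labelledCocycle κ g σ s = z := by
  obtain ⟨a, ha, rfl⟩ := z.exists_eq_ofCochain
  refine ⟨fun x => if h : ∃ τ : ⦋k⦌ ⟶ ⦋m⦌, x.2 = s ∘ τ.toOrderHom then
    transport κ h.choose σ (a h.choose) else 0, ?_⟩
  unfold labelledCocycle
  congr 1
  funext τ
  unfold labelledCochain
  by_cases hτ : Function.Injective τ.toOrderHom
  · rw [if_pos ⟨hs.comp hτ, fun i => hs0 _⟩]
    have h : ∃ τ' : ⦋k⦌ ⟶ ⦋m⦌, s ∘ τ.toOrderHom = s ∘ τ'.toOrderHom := ⟨τ, rfl⟩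
    have hc : h.choose = τ := by
      ext i : 3
      exact hs (congrFun h.choose_spec i).symm
    dsimp only
    rw [dif_pos h, hc, AddEquiv.symm_apply_apply]
  · rw [if_neg fun h => hτ (Function.Injective.of_comp h.1), ha τ hτ]

/-- The action of the functions on labelled simplices of `B` on the total space of a bundle with
fiber `K(π, k + 1)`. -/
noncomputable def labelledAction (κ : ∀ (q : ℕ) (σ : B _⦋q⦌), FiberCoordinates p π k σ) :
    LabelledAction p (B _⦋k⦌ × (Fin (k + 1) → ℕ) → π) where
  act g e s := fiberTranslate κ e (labelledCocycle κ g (p.app _ e) s)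
  proj_act _ _ _ := proj_fiberTranslate _ _
  add_act g h e s := by
    rw [proj_fiberTranslate, fiberTranslate_translate, labelledCocycle_add, add_comm]
  act_zero g e := by rw [labelledCocycle_zero, fiberTranslate_zero]
  map_act θ g e s := by
    rw [map_fiberTranslate, labelledCocycle_map, NatTrans.naturality_apply]
  exists_act_eq e e' s hs hs0 h := by
    obtain ⟨z, hz⟩ := exists_fiberTranslate_eq κ h
    obtain ⟨g, hg⟩ := exists_labelledCocycle_eq κ (p.app _ e) hs hs0 z
    exact ⟨g, by rw [hg, hz]⟩

end

theorem theoremA {E B : SSet.{u}} (p : E ⟶ B) (π : Type u) [AddCommGroup π] (n : ℕ) (hn : 1 < n)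
    (hp : IsLocallyTrivialBundle p (eilenbergMacLane π n)) (m : ℕ) :
    Function.Bijective (boundedCohomologyMap p m) ∧
      ∀ x : BoundedCohomology B m, ‖boundedCohomologyMap p m x‖ = ‖x‖ := by
  -- The action uses cochains one degree below the fiber's cocycles.
  obtain ⟨k, rfl⟩ : ∃ k, n = k + 1 := ⟨n - 1, by omega⟩
  let κ : ∀ (q : ℕ) (σ : B.obj (Opposite.op (SimplexCategory.mk q))), FiberCoordinates p π k σ :=
    fun _ σ => (nonempty_fiberCoordinates hp σ).some
  exact (labelledAction κ).isometric (fun m σ => ⟨(κ _ σ).point (𝟙 _) 0, proj_point_id σ 0⟩) m
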